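/- Let $n\in\mathbb N$, $k\in\mathbb R$, and let $\mathcal D^J_n=\mathbb C^n\times\mathcal D_n$, where $\mathcal D_n=\{W\in M(n,\mathbb C): W=W^t,\ 1-W\bar W>0\}$, with coordinates $z=(z_i)$ and $w_{ij}=w_{ji}$ (the independent ones being $w_{ij}$, $i\le j$). Put $M=(1-W\bar W)^{-1}$, $p=\frac k2-n-2$, $$2F=2\bar z^tMz+z^t\bar WMz+\bar z^tMW\bar z,\qquad \rho_1=\det(1-W\bar W)^{p}\,e^{-F},$$ $$(f,g)=\Lambda_n\int_{\mathcal D^J_n}\overline{f(z,W)}\,g(z,W)\,\rho_1\,dz\,dW,$$ where $dz=\prod_i d\Re z_i\,d\Im z_i$, $dW=\prod_{i\le j}d\Re w_{ij}\,d\Im w_{ij}$, and $\Lambda_n$ is the constant $$\Lambda_n=\frac{k-3}{2\pi^{n(n+3)/2}}\prod_{i=1}^{n-1}\frac{\left(\frac{k-3}2-n+i\right)\Gamma(k+i-2)}{\Gamma(k+2(i-n-1))}.$$ (For $k$ outside the range $k>2n+1$, read $\Lambda_n$ with the conventions $1/0=0$ and $\Gamma(-m)=0$ for $m\in\mathbb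 N$.) Let $\mathcal F_K$ be the space of holomorphic functions $f$ on $\mathcal D^J_n$ with $\int_{\mathcal D^J_n}|f|^2\rho_1\,dz\,dW<\infty$. With $\nabla_{ij}=\frac{1+\delta_{ij}}2\frac{\partial}{\partial w_{ij}}$, consider the differential operators ($1\le r,s\le n$, sums over repeated indices $i,\alpha=1,\dots,n$; this is the case $k_1=\dots=k_n=k$) $$\mathbf a_r=\frac{\partial}{\partial z_r},\qquad \mathbf a^\dagger_r=z_r+w_{ri}\frac{\partial}{\partial z_i},\qquad \mathbf K^-_{rs}=\nabla_{rs},\qquad \mathbf K^0_{rs}=\frac k4\delta_{rs}+\frac{z_r}2\frac{\partial}{\partial z_s}+w_{ri}\nabla_{is},$$ $$\mathbf K^+_{rs}=\frac k2w_{rs}+\frac{z_rz_s}2+\frac12(z_sw_{ir}+z_rw_{is})\frac{\partial}{\partial z_i}+w_{\alpha s}w_{ri}\nabla_{i\alpha}.$$ Then the pairs $\mathbf a_r$ and $\mathbf a_r^\dagger$, $\mathbf K^+_{rs}$ and $\mathbf K^-_{rs}$, $\mathbf K^0_{rs}$ and $\mathbf K^0_{sr}$ are hermitian conjugate with respect to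 $(\cdot,\cdot)$ on their maximal domains in $\mathcal F_K$: for each such pair $(A,B)$ one has $(Af,g)=(f,Bg)$ and $(Bg,f)=(g,Af)$ for all $f,g\in\mathcal F_K$ with $Af\in\mathcal F_K$ and $Bg\in\mathcal F_K$. -/

import Mathlib

open scoped ComplexOrder

noncomputable section

namespace SiegelJacobi

/-- Coordinates `(z, w)` on `ℂⁿ × {symmetric n × n complex matrices}`. The entry `w_{ij} = w_{ji}`
is the coordinate attached to the unordered pair `s(i, j)`, so that the independent coordinates are
`w_{ij}`, `i ≤ j`, and `volume` is the Lebesgue measure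
`∏ᵢ dRe zᵢ dIm zᵢ ∏_{i ≤ j} dRe w_{ij} dIm w_{ij}`. -/
abbrev Coord (n : ℕ) : Type := (Fin n → ℂ) × (Sym2 (Fin n) → ℂ)

/-- The symmetric matrix `W` of a point. -/
def wMat {n : ℕ} (x : Coord n) : Matrix (Fin n) (Fin n) ℂ :=
  Matrix.of fun i j => x.2 s(i, j)

/-- The entrywise conjugate `W̄`. -/
def wBar {n : ℕ} (x : Coord n) : Matrix (Fin n) (Fin n) ℂ :=
  (wMat x).map (starRingEnd ℂ)

/-- The entrywise conjugate `z̄`. -/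
def zBar {n : ℕ} (x : Coord n) : Fin n → ℂ := fun i => starRingEnd ℂ (x.1 i)

/-- The Siegel-Jacobi ball `ℂⁿ × 𝒟ₙ`, `𝒟ₙ = {W = Wᵗ : 1 - W W̄ > 0}`. -/
def ball (n : ℕ) : Set (Coord n) :=
  {x | (1 - wMat x * wBar x).PosDef}

/-- `M = (1 - W W̄)⁻¹`. -/
def mMat {n : ℕ} (x : Coord n) : Matrix (Fin n) (Fin n) ℂ :=
  (1 - wMat x * wBar x)⁻¹

/-- The function `F`, `2 F = 2 z̄ᵗ M z + zᵗ W̄ M z + z̄ᵗ M W z̄`. -/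
def potF {n : ℕ} (x : Coord n) : ℂ :=
  (2 * (zBar x ⬝ᵥ (mMat x).mulVec x.1)
    + x.1 ⬝ᵥ (wBar x * mMat x).mulVec x.1
    + zBar x ⬝ᵥ (mMat x * wMat x).mulVec (zBar x)) / 2

/-- The density `ρ₁ = det (1 - W W̄) ^ p * exp (-F)` with `p = k / 2 - n - 2`. Both the determinant
and `F` are real on the ball (and the determinant is positive there). -/
def density {n : ℕ} (k : ℝ) (x : Coord n) : ℝ :=
  (1 - wMat x * wBar x).det.re ^ (k / 2 - n - 2) * Real.exp (-(potF x).re)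

/-- The normalization constant `Λₙ`. -/
def normConst (n : ℕ) (k : ℝ) : ℝ :=
  (k - 3) / (2 * Real.pi ^ ((n : ℝ) * (n + 3) / 2)) *
    ∏ i ∈ Finset.Icc 1 (n - 1),
      ((k - 3) / 2 - n + i) * Real.Gamma (k + i - 2) / Real.Gamma (k + 2 * ((i : ℝ) - n - 1))

/-- The scalar product `(f, g) = Λₙ ∫ f̄ g ρ₁ dz dW` over the Siegel-Jacobi ball. -/
def scalarProd {n : ℕ} (k : ℝ) (f g : Coord n → ℂ) : ℂ :=
  (normConst n k : ℂ) *
    ∫ x in ball n, starRingEnd ℂ (f x) * g x * (density k x : ℂ)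

/-- Membership in the space `𝓕_K` of holomorphic functions on the Siegel-Jacobi ball which are
square integrable with respect to `ρ₁ dz dW`. -/
def MemFK {n : ℕ} (k : ℝ) (f : Coord n → ℂ) : Prop :=
  DifferentiableOn ℂ f (ball n) ∧
    MeasureTheory.IntegrableOn (fun x => ‖f x‖ ^ 2 * density k x) (ball n)

/-- `∂ / ∂zᵢ`. -/
def dz {n : ℕ} (i : Fin n) (f : Coord n → ℂ) (x : Coord n) : ℂ :=
  fderiv ℂ f x (Pi.single i 1, 0)

/-- `∂ / ∂w_{ij}`, the derivative in the coordinate `w_{ij} = w_{ji}`. -/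
def dw {n : ℕ} (i j : Fin n) (f : Coord n → ℂ) (x : Coord n) : ℂ :=
  fderiv ℂ f x (0, Pi.single s(i, j) 1)

/-- `∇_{ij} = χ_{ij} ∂ / ∂w_{ij}`, `χ_{ij} = (1 + δ_{ij}) / 2`. -/
def nabla {n : ℕ} (i j : Fin n) (f : Coord n → ℂ) (x : Coord n) : ℂ :=
  (1 + if i = j then 1 else 0) / 2 * dw i j f x

/-- `a_k = ∂ / ∂z_k`. -/
def opA {n : ℕ} (k : Fin n) (f : Coord n → ℂ) (x : Coord n) : ℂ :=
  dz k f x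

/-- `a†_k = z_k + ∑ᵢ w_{ki} ∂ / ∂zᵢ`. -/
def opAdag {n : ℕ} (k : Fin n) (f : Coord n → ℂ) (x : Coord n) : ℂ :=
  x.1 k * f x + ∑ i, wMat x k i * dz i f x

/-- `K⁰_{kl} = (k_k / 4) δ_{kl} + (z_k / 2) ∂ / ∂z_l + ∑ᵢ w_{ki} ∇_{il}`, for the weights
`κ = (k₁, …, kₙ)`. -/
def opK0 {n : ℕ} (κ : Fin n → ℝ) (k l : Fin n) (f : Coord n → ℂ) (x : Coord n) : ℂ :=
  (if k = l then (κ k : ℂ) / 4 else 0) * f x + x.1 k / 2 * dz l f x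
    + ∑ i, wMat x k i * nabla i l f x

/-- `K⁻_{kl} = ∇_{kl}`. -/
def opKminus {n : ℕ} (k l : Fin n) (f : Coord n → ℂ) (x : Coord n) : ℂ :=
  nabla k l f x

/-- `K⁺_{kl} = ((k_k + k_l) / 4) w_{kl} + z_k z_l / 2 + (1/2) ∑ᵢ (z_l w_{ik} + z_k w_{il}) ∂ / ∂zᵢ
  + ∑_{α, i} w_{αl} w_{ki} ∇_{iα}`, for the weights `κ = (k₁, …, kₙ)`. -/
def opKplus {n : ℕ} (κ : Fin n → ℝ) (k l : Fin n) (f : Coord n → ℂ) (x : Coord n) : ℂ :=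
  (((κ k : ℂ) + κ l) / 4 * wMat x k l + x.1 k * x.1 l / 2) * f x
    + 1 / 2 * ∑ i, (x.1 l * wMat x i k + x.1 k * wMat x i l) * dz i f x
    + ∑ α, ∑ i, wMat x α l * wMat x k i * nabla i α f x

/-- The operators `A` and `B`, each on its maximal domain in `𝓕_K` (all `f ∈ 𝓕_K` with
`A f ∈ 𝓕_K`, respectively all `g ∈ 𝓕_K` with `B g ∈ 𝓕_K`), are hermitian conjugate:
`(A f, g) = (f, B g)` and `(B g, f) = (g, A f)`. -/
def HermitianConjugate {n : ℕ} (k : ℝ) (A B : (Coord n → ℂ) → Coord n → ℂ) : Prop :=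
  ∀ f g : Coord n → ℂ, MemFK k f → MemFK k (A f) → MemFK k g → MemFK k (B g) →
    scalarProd k (A f) g = scalarProd k f (B g) ∧
    scalarProd k (B g) f = scalarProd k g (A f)

end SiegelJacobi

end

/-!
The three pairs have the form `A = c + X`, `B = d + Y`, where `X`, `Y` are holomorphic vector fields
with polynomial coefficients. Since `f`, `g` are holomorphic,
`conj (A f) g - conj f (B g) = (c̄ - d) f̄ g + (X̄ - Y) (f̄ g)`: everything is governed by one
complexified real vector field `V = X̄ - Y`, which is an infinitesimal symmetry of the
Siegel-Jacobi ball. Two facts about `V` give the theorem.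

* Formal adjointness: `V log ρ₁ = c̄ - d - conj (div X) + div Y`, so that
  `(conj (A f) g - conj f (B g)) ρ₁` is a divergence. With `η = M (z + W z̄)` the derivatives of the
  potential are `∂F/∂z̄ = η`, `∂F/∂z = η̄`, `∂F/∂W̄ = η ηᵗ / 2`, `∂F/∂W = η̄ η̄ᵗ / 2`
  (`hasWirt_potF`), and `W η̄ = η - z`, `W̄ η = η̄ - z̄`; with these relations the identity is a short
  computation for each pair.
* No boundary terms: `V` is tangent to the boundary and grows at most linearly in `z`, so that
  `V log H` is bounded for `H = det (1 - W W̄) / (1 + |z|²)` (`hasWirt_exhaust`). If `φ` is a cutoff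
  function on the half-line, then `V (φ (m H)) = m H φ' (m H) V log H` is bounded uniformly in `m`
  and tends to `0` pointwise, and dominated convergence applies, since `conj (A f) g ρ₁`,
  `conj f (B g) ρ₁` and `f̄ g ρ₁` are integrable (`setIntegral_adjoint`).

This works for every real `k`: only products of functions in `𝓕_K` are integrated, and no
estimate of the density at the boundary is needed.
-/

noncomputable section

namespace SiegelJacobi

open MeasureTheory Filter Topology Complex

/-! ### Complexified directional derivatives -/

section Wirtinger

variable {E : Type*} [NormedAddCommGroup E] [NormedSpace ℝ E] [NormedSpace ℂ E]

/-- The value on `X̄ - Y` of the complexification of a real-linear form `L`: the antiholomorphic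
derivative in the direction `X` minus the holomorphic derivative in the direction `Y`, when `L` is
the real derivative of a function. -/
def wirt (L : E →L[ℝ] ℂ) (X Y : E) : ℂ :=
  (L X + I * L (I • X)) / 2 - (L Y - I * L (I • Y)) / 2

/-- `u` is real-differentiable at `x`, and its derivative along `X̄ - Y` is `d`. -/
def HasWirt (u : E → ℂ) (x X Y : E) (d : ℂ) : Prop :=
  ∃ L : E →L[ℝ] ℂ, HasFDerivAt u L x ∧ wirt L X Y = d

variable {u v : E → ℂ} {x X Y : E} {d d' : ℂ}

lemma HasWirt.wirt_fderiv (h : HasWirt u x X Y d) : wirt (fderiv ℝ u x) X Y = d := by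
  obtain ⟨L, hL, rfl⟩ := h
  rw [hL.fderiv]

lemma hasWirt_fderiv (h : DifferentiableAt ℝ u x) :
    HasWirt u x X Y (wirt (fderiv ℝ u x) X Y) :=
  ⟨_, h.hasFDerivAt, rfl⟩

lemma HasWirt.congr_val (h : HasWirt u x X Y d) (hd : d = d') : HasWirt u x X Y d' := hd ▸ h

lemma HasWirt.congr (h : HasWirt u x X Y d) (huv : v =ᶠ[𝓝 x] u) : HasWirt v x X Y d := by
  obtain ⟨L, hL, rfl⟩ := h
  exact ⟨L, hL.congr_of_eventuallyEq huv, rfl⟩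

lemma HasWirt.unique (h : HasWirt u x X Y d) (h' : HasWirt u x X Y d') : d = d' :=
  h.wirt_fderiv.symm.trans h'.wirt_fderiv

lemma hasWirt_const (c : ℂ) : HasWirt (fun _ : E => c) x X Y 0 :=
  ⟨0, hasFDerivAt_const c x, by simp [wirt]⟩

lemma HasWirt.add (hu : HasWirt u x X Y d) (hv : HasWirt v x X Y d') :
    HasWirt (fun y => u y + v y) x X Y (d + d') := by
  obtain ⟨L, hL, rfl⟩ := hu
  obtain ⟨L', hL', rfl⟩ := hv
  refine ⟨_, hL.add hL', ?_⟩
  simp only [wirt, add_apply]; ring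

lemma HasWirt.sub (hu : HasWirt u x X Y d) (hv : HasWirt v x X Y d') :
    HasWirt (fun y => u y - v y) x X Y (d - d') := by
  obtain ⟨L, hL, rfl⟩ := hu
  obtain ⟨L', hL', rfl⟩ := hv
  refine ⟨_, hL.sub hL', ?_⟩
  simp only [wirt, sub_apply]; ring

lemma HasWirt.mul (hu : HasWirt u x X Y d) (hv : HasWirt v x X Y d') :
    HasWirt (fun y => u y * v y) x X Y (d * v x + u x * d') := by
  obtain ⟨L, hL, rfl⟩ := hu
  obtain ⟨L', hL', rfl⟩ := hv
  refine ⟨_, hL.mul hL', ?_⟩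
  simp only [wirt, add_apply, smul_apply, smul_eq_mul]; ring

lemma HasWirt.sum {ι : Type*} {s : Finset ι} {u : ι → E → ℂ} {d : ι → ℂ}
    (h : ∀ i ∈ s, HasWirt (u i) x X Y (d i)) :
    HasWirt (fun y => ∑ i ∈ s, u i y) x X Y (∑ i ∈ s, d i) := by
  classical
  induction s using Finset.induction_on with
  | empty => simpa using hasWirt_const (x := x) (X := X) (Y := Y) 0
  | insert i s hi ih =>
    simp only [Finset.sum_insert hi]
    exact (h i (by simp)).add (ih fun j hj => h j (by simp [hj]))

/-- Chain rule for a real function of a real-valued function. -/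
lemma HasWirt.ofReal_comp {r : E → ℝ} {ψ : ℝ → ℝ} {ψ' : ℝ}
    (hr : HasWirt (fun y => (r y : ℂ)) x X Y d) (hψ : HasDerivAt ψ ψ' (r x)) :
    HasWirt (fun y => (ψ (r y) : ℂ)) x X Y (ψ' * d) := by
  obtain ⟨L, hL, rfl⟩ := hr
  have h1 : HasFDerivAt r (reCLM ∘L L) x := by
    simpa [Function.comp_def] using reCLM.hasFDerivAt.comp x hL
  have h2 := ofRealCLM.hasFDerivAt.comp x h1
  have h3 (w : E) : L w = ((L w).re : ℂ) :=
    DFunLike.congr_fun (hL.unique (by simpa [Function.comp_def] using h2)) w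
  refine ⟨_, ofRealCLM.hasFDerivAt.comp x (hψ.comp_hasFDerivAt x h1), ?_⟩
  simp only [wirt, ContinuousLinearMap.comp_apply, smul_apply, reCLM_apply, smul_eq_mul,
    ofRealCLM_apply, ofReal_mul, ← h3]
  ring

lemma HasWirt.of_conj (hu : HasWirt u x Y X d) :
    HasWirt (fun y => starRingEnd ℂ (u y)) x X Y (-starRingEnd ℂ d) := by
  obtain ⟨L, hL, rfl⟩ := hu
  refine ⟨_, (conjCLE : ℂ →L[ℝ] ℂ).hasFDerivAt.comp x hL, ?_⟩
  simp [wirt, map_ofNat]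
  ring

variable [IsScalarTower ℝ ℂ E]

lemma hasWirt_of_hasFDerivAt {f' : E →L[ℂ] ℂ} (h : HasFDerivAt u f' x) :
    HasWirt u x X Y (-f' Y) := by
  refine ⟨_, h.restrictScalars ℝ, ?_⟩
  simp only [wirt, ContinuousLinearMap.coe_restrictScalars', map_smul, smul_eq_mul]
  linear_combination (f' X / 2 + f' Y / 2) * I_mul_I

lemma hasWirt_conj_of_hasFDerivAt {f' : E →L[ℂ] ℂ} (h : HasFDerivAt u f' x) :
    HasWirt (fun y => starRingEnd ℂ (u y)) x X Y (starRingEnd ℂ (f' X)) := by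
  simpa using (hasWirt_of_hasFDerivAt (X := Y) (Y := X) h).of_conj

lemma apply_smul_real (L : E →L[ℝ] ℂ) (c : ℂ) (v : E) :
    L (c • v) = c.re * L v + c.im * L (I • v) := by
  have hr (r : ℝ) (w : E) : (r : ℂ) • w = r • w := algebraMap_smul ℂ r w
  have h : c • v = c.re • v + c.im • (I • v) := by
    conv_lhs => rw [← re_add_im c]
    rw [add_smul, mul_smul, hr, hr]
  rw [h, map_add, map_smul, map_smul, real_smul, real_smul]

/-- `wirt` is antilinear in its first and linear in its second direction. -/
lemma wirt_sum {ι : Type*} (s : Finset ι) (L : E →L[ℝ] ℂ) (a b : ι → ℂ) (e : ι → E) :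
    wirt L (∑ i ∈ s, a i • e i) (∑ i ∈ s, b i • e i)
      = ∑ i ∈ s, (starRingEnd ℂ (a i) * wirt L (e i) 0 + b i * wirt L 0 (e i)) := by
  have h (i : ι) : starRingEnd ℂ (a i) * wirt L (e i) 0 + b i * wirt L 0 (e i)
      = wirt L (a i • e i) (b i • e i) := by
    have h1 (c : ℂ) : L (I • c • e i) = (I * c).re * L (e i) + (I * c).im * L (I • e i) := by
      rw [← mul_smul, apply_smul_real]
    simp only [wirt, smul_zero, map_zero, h1, apply_smul_real L (a i), apply_smul_real L (b i)]
    apply Complex.ext <;> simp <;> ring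
  simp only [h]
  simp only [wirt, Finset.smul_sum, map_sum, Finset.mul_sum, ← Finset.sum_add_distrib,
    ← Finset.sum_sub_distrib, Finset.sum_div]

end Wirtinger

/-! ### Holomorphic functions of several variables are continuously differentiable -/

section Smooth

variable {E : Type*} [NormedAddCommGroup E] [NormedSpace ℂ E]

/-- The restrictions of `f` to the discs `ζ ↦ x + ζ v` depend continuously on `x`, locally uniformly
in `ζ`, hence by Weierstrass so do their derivatives at `0`. -/
lemma continuousOn_fderiv_apply {U : Set E} (hU : IsOpen U) {f : E → ℂ}
    (hf : DifferentiableOn ℂ f U) (v : E) : ContinuousOn (fun x => fderiv ℂ f x v) U := by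
  intro x₀ hx₀
  apply ContinuousAt.continuousWithinAt
  have hc : Continuous fun p : E × ℂ => p.1 + p.2 • v := by fun_prop
  have h0 : ∀ᶠ p : E × ℂ in 𝓝 (x₀, 0), p.1 + p.2 • v ∈ U :=
    hc.continuousAt.eventually_mem (hU.mem_nhds (by simpa using hx₀))
  rw [nhds_prod_eq] at h0
  obtain ⟨pa, ha, pb, hb, hab⟩ := eventually_prod_iff.1 h0
  obtain ⟨R, hR, hRb⟩ := Metric.eventually_nhds_iff_ball.1 hb
  have hder {x : E} (hx : pa x) {ζ : ℂ} (hζ : ζ ∈ Metric.ball (0 : ℂ) R) :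
      HasDerivAt (fun t : ℂ => f (x + t • v)) (fderiv ℂ f (x + ζ • v) v) ζ := by
    have h1 : HasFDerivAt f (fderiv ℂ f (x + ζ • v)) (x + ζ • v) :=
      (hf.differentiableAt (hU.mem_nhds (hab hx (hRb ζ hζ)))).hasFDerivAt
    have h2 : HasDerivAt (fun t : ℂ => x + t • v) v ζ := by
      simpa using ((hasDerivAt_id ζ).smul_const v).const_add x
    exact h1.comp_hasDerivAt ζ h2
  have hx₀a : pa x₀ := ha.self_of_nhds
  have hlim : TendstoLocallyUniformlyOn (fun (x : E) (t : ℂ) => f (x + t • v))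
      (fun t : ℂ => f (x₀ + t • v)) (𝓝 x₀) (Metric.ball 0 R) := by
    rw [Metric.tendstoLocallyUniformlyOn_iff]
    intro ε hε ζ hζ
    have hfc : ContinuousAt f (x₀ + ζ • v) :=
      hf.continuousOn.continuousAt (hU.mem_nhds (hab hx₀a (hRb ζ hζ)))
    have h3 : ∀ᶠ p : E × ℂ in 𝓝 x₀ ×ˢ 𝓝 ζ, dist (f (p.1 + p.2 • v)) (f (x₀ + ζ • v)) < ε / 2 := by
      rw [← nhds_prod_eq]
      have : ContinuousAt (fun p : E × ℂ => f (p.1 + p.2 • v)) (x₀, ζ) :=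
        ContinuousAt.comp (f := fun p : E × ℂ => p.1 + p.2 • v) hfc hc.continuousAt
      exact Metric.tendsto_nhds.1 this _ (half_pos hε)
    obtain ⟨qa, hqa, qb, hqb, hq⟩ := eventually_prod_iff.1 h3
    refine ⟨{t | qb t}, mem_nhdsWithin_of_mem_nhds hqb, ?_⟩
    filter_upwards [hqa] with x hx t ht
    calc _ ≤ dist (f (x₀ + t • v)) (f (x₀ + ζ • v)) + dist (f (x + t • v)) (f (x₀ + ζ • v)) :=
          dist_triangle_right _ _ _
      _ < ε / 2 + ε / 2 := add_lt_add (hq hqa.self_of_nhds ht) (hq hx ht)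
      _ = ε := add_halves ε
  have h4 := hlim.deriv
    (ha.mono fun x hx ζ hζ => (hder hx hζ).differentiableAt.differentiableWithinAt)
    Metric.isOpen_ball
  have h5 := h4.tendsto_at (Metric.mem_ball_self hR)
  have h6 {x : E} (hx : pa x) : deriv (fun t : ℂ => f (x + t • v)) 0 = fderiv ℂ f x v := by
    simpa using (hder hx (Metric.mem_ball_self hR)).deriv
  rw [h6 hx₀a] at h5
  exact h5.congr' (ha.mono fun x hx => h6 hx)

/-- A holomorphic function of several variables is `C¹`; by restriction of scalars this makes the
divergence theorem available. -/
lemma contDiffOn_one_of_differentiableOn [FiniteDimensional ℂ E] {U : Set E} (hU : IsOpen U)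
    {f : E → ℂ} (hf : DifferentiableOn ℂ f U) : ContDiffOn ℂ 1 f U := by
  rw [show (1 : WithTop ℕ∞) = 0 + 1 by norm_num, contDiffOn_succ_iff_fderiv_of_isOpen hU]
  refine ⟨hf, by simp, contDiffOn_zero.2 ?_⟩
  exact continuousOn_clm_apply.2 (continuousOn_fderiv_apply hU hf)

end Smooth

/-! ### A cutoff function on the half-line -/

/-- A smooth function of a real variable that vanishes for `t ≤ 1` and is `1` for `2 ≤ t`. -/
def cutoff (t : ℝ) : ℝ := Real.smoothTransition (t - 1)

lemma contDiff_cutoff : ContDiff ℝ 1 cutoff :=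
  (Real.smoothTransition.contDiff (n := 1)).comp (contDiff_id.sub contDiff_const)

lemma cutoff_of_le {t : ℝ} (h : t ≤ 1) : cutoff t = 0 :=
  Real.smoothTransition.zero_of_nonpos (by linarith)

lemma cutoff_of_ge {t : ℝ} (h : 2 ≤ t) : cutoff t = 1 :=
  Real.smoothTransition.one_of_one_le (by linarith)

lemma abs_cutoff_le (t : ℝ) : |cutoff t| ≤ 1 := by
  rw [cutoff, abs_of_nonneg (Real.smoothTransition.nonneg _)]
  exact Real.smoothTransition.le_one _

lemma hasDerivAt_cutoff (t : ℝ) : HasDerivAt cutoff (deriv cutoff t) t :=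
  (contDiff_cutoff.differentiable one_ne_zero t).hasDerivAt

lemma deriv_cutoff_of_lt {t : ℝ} (h : t < 1) : deriv cutoff t = 0 := by
  have : cutoff =ᶠ[𝓝 t] fun _ => 0 :=
    (eventually_lt_nhds h).mono fun s hs => cutoff_of_le hs.le
  simp [this.deriv_eq]

lemma deriv_cutoff_of_gt {t : ℝ} (h : 2 < t) : deriv cutoff t = 0 := by
  have : cutoff =ᶠ[𝓝 t] fun _ => 1 :=
    (eventually_gt_nhds h).mono fun s hs => cutoff_of_ge hs.le
  simp [this.deriv_eq]

lemma exists_abs_mul_deriv_cutoff_le : ∃ C : ℝ, ∀ t, |t * deriv cutoff t| ≤ C := by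
  have hc : Continuous fun t => |t * deriv cutoff t| :=
    (continuous_id.mul (contDiff_cutoff.continuous_deriv le_rfl)).abs
  obtain ⟨C, hC⟩ := (isCompact_Icc (a := (1 : ℝ)) (b := 2)).bddAbove_image hc.continuousOn
  refine ⟨max C 0, fun t => ?_⟩
  by_cases ht : t ∈ Set.Icc (1 : ℝ) 2
  · exact (hC (Set.mem_image_of_mem _ ht)).trans (le_max_left _ _)
  · have : deriv cutoff t = 0 := by
      rcases lt_or_ge t 1 with h | h
      · exact deriv_cutoff_of_lt h
      · exact deriv_cutoff_of_gt (not_le.1 fun h' => ht ⟨h, h'⟩)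
    simp [this]

/-! ### Integration by parts for holomorphic first-order operators -/

section Adjoint

variable {E : Type*} [NormedAddCommGroup E] [NormedSpace ℝ E] [MeasurableSpace E] [BorelSpace E]

lemma integral_fderiv_apply_eq_zero [FiniteDimensional ℝ E] {μ : Measure E} [μ.IsAddHaarMeasure]
    {u : E → ℂ} (hu : ContDiff ℝ 1 u) (hs : HasCompactSupport u) (v : E) :
    Integrable (fun x => fderiv ℝ u x v) μ ∧ ∫ x, fderiv ℝ u x v ∂μ = 0 := by
  have hi : Integrable (fun x => fderiv ℝ u x v) μ :=
    ((hu.continuous_fderiv one_ne_zero).clm_apply continuous_const).integrable_of_hasCompactSupport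
      (hs.fderiv_apply (𝕜 := ℝ) v)
  refine ⟨hi, ?_⟩
  have hi' : Integrable u μ := hu.continuous.integrable_of_hasCompactSupport hs
  have h := integral_bilinear_hasLineDerivAt_right_eq_neg_left_of_integrable (μ := μ)
    (f := u) (f' := fun x => fderiv ℝ u x v) (g := fun _ => (1 : ℂ)) (g' := fun _ => 0) (v := v)
    (B := ContinuousLinearMap.mul ℝ ℂ) (by simpa using hi) (by simp) (by simpa using hi')
    (fun x _ => (hu.differentiable one_ne_zero x).hasFDerivAt.hasLineDerivAt v)
    (fun x _ => (hasFDerivAt_const (1 : ℂ) x).hasLineDerivAt v)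
  simpa [eq_comm] using h

variable [NormedSpace ℂ E]

lemma integral_wirt_eq_zero [FiniteDimensional ℝ E] {μ : Measure E} [μ.IsAddHaarMeasure]
    {u : E → ℂ} (hu : ContDiff ℝ 1 u) (hs : HasCompactSupport u) (X Y : E) :
    Integrable (fun x => wirt (fderiv ℝ u x) X Y) μ ∧ ∫ x, wirt (fderiv ℝ u x) X Y ∂μ = 0 := by
  have h (v : E) := integral_fderiv_apply_eq_zero (μ := μ) hu hs v
  have h1 := ((h X).1.add ((h (I • X)).1.const_mul I)).div_const 2
  have h2 := ((h Y).1.sub ((h (I • Y)).1.const_mul I)).div_const 2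
  refine ⟨h1.sub h2, ?_⟩
  have e1 : ∫ x, (fderiv ℝ u x X + I * fderiv ℝ u x (I • X)) / 2 ∂μ = 0 := by
    rw [integral_div, integral_add (h X).1 ((h (I • X)).1.const_mul I), integral_const_mul,
      (h X).2, (h (I • X)).2]
    simp
  have e2 : ∫ x, (fderiv ℝ u x Y - I * fderiv ℝ u x (I • Y)) / 2 ∂μ = 0 := by
    rw [integral_div, integral_sub (h Y).1 ((h (I • Y)).1.const_mul I), integral_const_mul,
      (h Y).2, (h (I • Y)).2]
    simp
  calc _ = ∫ x, (fderiv ℝ u x X + I * fderiv ℝ u x (I • X)) / 2 ∂μ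
        - ∫ x, (fderiv ℝ u x Y - I * fderiv ℝ u x (I • Y)) / 2 ∂μ := integral_sub h1 h2
    _ = 0 := by rw [e1, e2, sub_zero]

variable [IsScalarTower ℝ ℂ E]

/-- Formal adjointness with respect to `ρ`, in a form that does not involve test functions: if the
complexified vector field `X̄ - Y` (`X = ∑ aᵢ eᵢ`, `Y = ∑ bᵢ eᵢ`) differentiates `log ρ` to
`c̄ - d - conj (div a) + div b` and `log H` to a bounded function, where `H` is a
positive exhaustion function of `U` (it tends to `0` at the boundary and at infinity), then `c + X`
and `d + Y` are adjoint on all pairs of holomorphic functions for which the integrals converge.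
Cutting off by `cutoff (m H)` removes the boundary terms: on the support of the derivative of the
cutoff, `m H` is bounded, so that this derivative along `X̄ - Y` is bounded uniformly in `m`. -/
theorem setIntegral_adjoint [FiniteDimensional ℝ E] [FiniteDimensional ℂ E] {μ : Measure E}
    [μ.IsAddHaarMeasure]
    {U : Set E} (hU : IsOpen U) {ρ H : E → ℝ} (hρ : ContDiffOn ℝ 1 ρ U) (hH : ContDiffOn ℝ 1 H U)
    (hHpos : ∀ x ∈ U, 0 < H x) (hHc : ∀ ε > 0, IsCompact {x | x ∈ U ∧ ε ≤ H x})
    {ι : Type*} [Fintype ι] (e : ι → E) {a b : ι → E → ℂ} {c d : E → ℂ}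
    (ha : ∀ i, ContDiff ℂ 1 (a i)) (hb : ∀ i, ContDiff ℂ 1 (b i))
    (hVρ : ∀ x ∈ U, HasWirt (fun y => (ρ y : ℂ)) x (∑ i, a i x • e i) (∑ i, b i x • e i)
      ((starRingEnd ℂ (c x) - d x - starRingEnd ℂ (∑ i, fderiv ℂ (a i) x (e i))
        + ∑ i, fderiv ℂ (b i) x (e i)) * ρ x))
    {C : ℝ} (hVH : ∀ x ∈ U, ∃ l, HasWirt (fun y => (H y : ℂ)) x (∑ i, a i x • e i)
      (∑ i, b i x • e i) (l * H x) ∧ ‖l‖ ≤ C)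
    {f g Af Bg : E → ℂ} (hf : DifferentiableOn ℂ f U) (hg : DifferentiableOn ℂ g U)
    (hA : ∀ x ∈ U, Af x = c x * f x + fderiv ℂ f x (∑ i, a i x • e i))
    (hB : ∀ x ∈ U, Bg x = d x * g x + fderiv ℂ g x (∑ i, b i x • e i))
    (hfg : IntegrableOn (fun x => starRingEnd ℂ (f x) * g x * ρ x) U μ)
    (hAfg : IntegrableOn (fun x => starRingEnd ℂ (Af x) * g x * ρ x) U μ)
    (hfBg : IntegrableOn (fun x => starRingEnd ℂ (f x) * Bg x * ρ x) U μ) :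
    ∫ x in U, starRingEnd ℂ (Af x) * g x * ρ x ∂μ
      = ∫ x in U, starRingEnd ℂ (f x) * Bg x * ρ x ∂μ := by
  classical
  -- the compactly supported function to which the divergence theorem is applied
  let Φ : ℕ → E → ℂ := fun m =>
    U.indicator fun x => starRingEnd ℂ (f x) * g x * ρ x * (cutoff (m * H x) : ℝ)
  let K : ℕ → Set E := fun m => {x | x ∈ U ∧ ((m : ℝ) + 1)⁻¹ ≤ H x}
  have hK (m : ℕ) : IsCompact (K m) := hHc _ (by positivity)
  have hΦ0 (m : ℕ) (x : E) (hx : x ∉ K m) : Φ m x = 0 := by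
    by_cases hxU : x ∈ U
    -- `m + 1` instead of `m` in the definition of `K m` covers `m = 0`
    · have h1 : H x < ((m : ℝ) + 1)⁻¹ := not_le.1 fun h => hx ⟨hxU, h⟩
      have h2 : (m : ℝ) * H x ≤ 1 := by
        have h3 := (lt_inv_comm₀ (hHpos x hxU) (by positivity)).1 h1
        have h4 := mul_lt_mul_of_pos_left h3 (hHpos x hxU)
        rw [mul_inv_cancel₀ (hHpos x hxU).ne'] at h4
        nlinarith [hHpos x hxU]
      simp [Φ, hxU, cutoff_of_le h2]
    · simp [Φ, hxU]
  have hΦs (m : ℕ) : HasCompactSupport (Φ m) := HasCompactSupport.intro (hK m) (hΦ0 m)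
  have hΦeq (m : ℕ) {x : E} (hx : x ∈ U) : Φ m =ᶠ[𝓝 x]
      fun x => starRingEnd ℂ (f x) * g x * ρ x * (cutoff (m * H x) : ℝ) :=
    (hU.eventually_mem hx).mono fun y hy => Set.indicator_of_mem hy _
  have hfC := (contDiffOn_one_of_differentiableOn hU hf).restrict_scalars ℝ
  have hgC := (contDiffOn_one_of_differentiableOn hU hg).restrict_scalars ℝ
  have hΦz (m : ℕ) {x : E} (hx : x ∉ K m) : Φ m =ᶠ[𝓝 x] fun _ => 0 :=
    ((hK m).isClosed.isOpen_compl.eventually_mem hx).mono (hΦ0 m)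
  have hΦC (m : ℕ) : ContDiff ℝ 1 (Φ m) := by
    rw [contDiff_iff_contDiffAt]
    intro x
    by_cases hxU : x ∈ U
    · refine ContDiffAt.congr_of_eventuallyEq ?_ (hΦeq m hxU)
      have hn := hU.mem_nhds hxU
      have h1 := (conjCLE.contDiff (n := 1)).contDiffAt.comp x (hfC.contDiffAt hn)
      have h2 := (ofRealCLM.contDiff (n := 1)).contDiffAt.comp x (hρ.contDiffAt hn)
      have h3 := (ofRealCLM.contDiff (n := 1)).contDiffAt.comp x
        (contDiff_cutoff.contDiffAt.comp x
          (contDiffAt_const (c := (m : ℝ)) |>.mul (hH.contDiffAt hn)))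
      exact ((h1.mul (hgC.contDiffAt hn)).mul h2).mul h3
    · exact contDiffAt_const.congr_of_eventuallyEq (hΦz m fun h => hxU h.1)
  have haC (i : ι) : ContDiff ℝ 1 fun x => starRingEnd ℂ (a i x) :=
    conjCLE.contDiff.comp ((ha i).restrict_scalars ℝ)
  have hbC (i : ι) : ContDiff ℝ 1 (b i) := (hb i).restrict_scalars ℝ
  let F : ℕ → E → ℂ := fun m x => ∑ i,
    (wirt (fderiv ℝ (fun y => starRingEnd ℂ (a i y) * Φ m y) x) (e i) 0
      + wirt (fderiv ℝ (fun y => b i y * Φ m y) x) 0 (e i))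
  have hI1 (m : ℕ) (i : ι) := integral_wirt_eq_zero (μ := μ) ((haC i).mul (hΦC m))
    ((hΦs m).mul_left) (e i) 0
  have hI2 (m : ℕ) (i : ι) := integral_wirt_eq_zero (μ := μ) ((hbC i).mul (hΦC m))
    ((hΦs m).mul_left) 0 (e i)
  have hFi (m : ℕ) : Integrable (F m) μ :=
    integrable_finsetSum _ fun i _ => (hI1 m i).1.add (hI2 m i).1
  have hF0 (m : ℕ) : ∫ x, F m x ∂μ = 0 := by
    rw [show ∫ x, F m x ∂μ = _ from integral_finsetSum _ fun i _ => (hI1 m i).1.add (hI2 m i).1]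
    refine Finset.sum_eq_zero fun i _ => ?_
    calc _ = _ := integral_add (hI1 m i).1 (hI2 m i).1
      _ = 0 := by rw [(hI1 m i).2, (hI2 m i).2, add_zero]
  have hFout (m : ℕ) (x : E) (hx : x ∉ U) : F m x = 0 := by
    have h (w : E → ℂ) : fderiv ℝ (fun y => w y * Φ m y) x = 0 := by
      have : (fun y => w y * Φ m y) =ᶠ[𝓝 x] fun _ => 0 :=
        (hΦz m fun h => hx h.1).mono fun y hy => by simp [hy]
      simp [this.fderiv_eq]
    simp only [F, h]
    simp [wirt]
  have hFU0 (m : ℕ) : ∫ x in U, F m x ∂μ = 0 := by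
    rw [setIntegral_eq_integral_of_forall_compl_eq_zero (hFout m), hF0]
  choose! l hl hlC using hVH
  -- on `U` the divergence is the integrand of the claim, cut off, plus a term carrying the
  -- derivative of the cutoff
  have hFU (m : ℕ) (x : E) (hx : x ∈ U) : F m x
      = (starRingEnd ℂ (Af x) * g x * ρ x - starRingEnd ℂ (f x) * Bg x * ρ x)
          * (cutoff (m * H x) : ℝ)
        + starRingEnd ℂ (f x) * g x * ρ x
          * ((m * H x * deriv cutoff (m * H x) : ℝ) * l x) := by
    have hn := hU.mem_nhds hx
    have hfd := (hf.differentiableAt hn).hasFDerivAt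
    have hgd := (hg.differentiableAt hn).hasFDerivAt
    have hχ : HasWirt (fun y => ((cutoff (m * H y) : ℝ) : ℂ)) x (∑ i, a i x • e i)
        (∑ i, b i x • e i) ((deriv cutoff (m * H x) : ℝ) * (m * (l x * H x))) := by
      have h1 : HasWirt (fun y => ((m * H y : ℝ) : ℂ)) x (∑ i, a i x • e i)
          (∑ i, b i x • e i) (m * (l x * H x)) := by
        simpa using (hasWirt_const (m : ℂ)).mul (hl x hx)
      exact h1.ofReal_comp (hasDerivAt_cutoff _)
    have hΦW := ((((hasWirt_conj_of_hasFDerivAt hfd).mul (hasWirt_of_hasFDerivAt hgd)).mul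
      (hVρ x hx)).mul hχ).congr (hΦeq m hx)
    have hΦD : DifferentiableAt ℝ (Φ m) x := (hΦC m).differentiable one_ne_zero x
    have haD (i : ι) := ((ha i).differentiable one_ne_zero x).hasFDerivAt
    have hbD (i : ι) := ((hb i).differentiable one_ne_zero x).hasFDerivAt
    have h1 (i : ι) := ((hasWirt_conj_of_hasFDerivAt (X := e i) (Y := 0) (haD i)).mul
      (hasWirt_fderiv hΦD)).wirt_fderiv
    have h2 (i : ι) := ((hasWirt_of_hasFDerivAt (X := 0) (Y := e i) (hbD i)).mul
      (hasWirt_fderiv hΦD)).wirt_fderiv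
    have h3 : F m x = (starRingEnd ℂ (∑ i, fderiv ℂ (a i) x (e i)) - ∑ i, fderiv ℂ (b i) x (e i))
        * Φ m x + wirt (fderiv ℝ (Φ m) x) (∑ i, a i x • e i) (∑ i, b i x • e i) := by
      simp only [F, h1, h2]
      rw [wirt_sum, map_sum, ← Finset.sum_sub_distrib, Finset.sum_mul, ← Finset.sum_add_distrib]
      exact Finset.sum_congr rfl fun i _ => by ring
    rw [h3, hΦW.wirt_fderiv, hA x hx, hB x hx, (hΦeq m hx).self_of_nhds]
    simp only [map_add, map_mul, ofReal_mul, ofReal_natCast]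
    ring
  -- passage to the limit
  obtain ⟨C', hC'⟩ := exists_abs_mul_deriv_cutoff_le
  have hlim : Tendsto (fun m => ∫ x in U, F m x ∂μ) atTop
      (𝓝 (∫ x in U, starRingEnd ℂ (Af x) * g x * ρ x - starRingEnd ℂ (f x) * Bg x * ρ x ∂μ)) := by
    refine tendsto_integral_of_dominated_convergence
      (fun x => ‖starRingEnd ℂ (Af x) * g x * ρ x - starRingEnd ℂ (f x) * Bg x * ρ x‖
        + ‖starRingEnd ℂ (f x) * g x * ρ x‖ * (C' * C))
      (fun m => (hFi m).aestronglyMeasurable.restrict)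
      ((hAfg.sub hfBg).norm.add (hfg.norm.mul_const _)) (fun m => ?_) ?_
    · refine (ae_restrict_iff' hU.measurableSet).2 (Eventually.of_forall fun x hx => ?_)
      rw [hFU m x hx]
      refine (norm_add_le _ _).trans (add_le_add ?_ ?_)
      · rw [norm_mul, norm_real]
        exact mul_le_of_le_one_right (norm_nonneg _) (abs_cutoff_le _)
      · rw [norm_mul, norm_mul _ (l x), norm_real]
        exact mul_le_mul_of_nonneg_left (mul_le_mul (hC' _) (hlC x hx) (norm_nonneg _)
          ((abs_nonneg _).trans (hC' 0))) (norm_nonneg _)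
    · refine (ae_restrict_iff' hU.measurableSet).2 (Eventually.of_forall fun x hx => ?_)
      refine tendsto_const_nhds.congr' ?_
      have hm : ∀ᶠ m : ℕ in atTop, 2 < m * H x :=
        (tendsto_natCast_atTop_atTop.atTop_mul_const (hHpos x hx)).eventually_gt_atTop 2
      filter_upwards [hm] with m hm
      rw [hFU m x hx, cutoff_of_ge hm.le, deriv_cutoff_of_gt hm]
      simp
  simp only [hFU0] at hlim
  rw [← sub_eq_zero, ← integral_sub hAfg hfBg]
  exact (tendsto_nhds_unique hlim tendsto_const_nhds)

end Adjoint

open Matrix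

/-! ### Derivatives of matrix-valued functions -/

section MatrixCalculus

variable {E : Type*} [NormedAddCommGroup E] [NormedSpace ℝ E] [NormedSpace ℂ E]
  {m n o : Type*} [Fintype m] [Fintype n] [Fintype o] {x X Y : E}

/-- Entrywise `HasWirt` for vector-valued functions. -/
def HasWirtVec (a : E → n → ℂ) (x X Y : E) (d : n → ℂ) : Prop :=
  ∀ i, HasWirt (fun y => a y i) x X Y (d i)

/-- Entrywise `HasWirt` for matrix-valued functions. -/
def HasWirtMat (A : E → Matrix m n ℂ) (x X Y : E) (D : Matrix m n ℂ) : Prop :=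
  ∀ i j, HasWirt (fun y => A y i j) x X Y (D i j)

lemma HasWirtVec.dotProduct {a b : E → n → ℂ} {d d' : n → ℂ} (ha : HasWirtVec a x X Y d)
    (hb : HasWirtVec b x X Y d') :
    HasWirt (fun y => a y ⬝ᵥ b y) x X Y (d ⬝ᵥ b x + a x ⬝ᵥ d') :=
  (HasWirt.sum fun i _ => (ha i).mul (hb i)).congr_val
    (by simp [_root_.dotProduct, Finset.sum_add_distrib])

omit [Fintype m] in
lemma HasWirtMat.mulVec {A : E → Matrix m n ℂ} {D : Matrix m n ℂ} {a : E → n → ℂ} {d : n → ℂ}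
    (hA : HasWirtMat A x X Y D) (ha : HasWirtVec a x X Y d) :
    HasWirtVec (fun y => A y *ᵥ a y) x X Y (D *ᵥ a x + A x *ᵥ d) := fun i =>
  HasWirtVec.dotProduct (a := fun y => A y i) (fun j => hA i j) ha

omit [Fintype m] [Fintype o] in
lemma HasWirtMat.mul {A : E → Matrix m n ℂ} {D : Matrix m n ℂ} {B : E → Matrix n o ℂ}
    {D' : Matrix n o ℂ} (hA : HasWirtMat A x X Y D) (hB : HasWirtMat B x X Y D') :
    HasWirtMat (fun y => A y * B y) x X Y (D * B x + A x * D') := fun i j =>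
  HasWirtVec.dotProduct (a := fun y => A y i) (b := fun y k => B y k j)
    (fun k => hA i k) (fun k => hB k j)

variable [DecidableEq n]

lemma hasWirt_prod {ι : Type*} [DecidableEq ι] (s : Finset ι) {u : ι → E → ℂ} {d : ι → ℂ}
    (h : ∀ i ∈ s, HasWirt (u i) x X Y (d i)) :
    HasWirt (fun y => ∏ i ∈ s, u i y) x X Y (∑ i ∈ s, (∏ j ∈ s.erase i, u j x) * d i) := by
  induction s using Finset.induction_on with
  | empty => simpa using hasWirt_const (x := x) (X := X) (Y := Y) 1
  | insert i s hi ih =>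
    simp only [Finset.prod_insert hi, Finset.sum_insert hi]
    refine ((h i (by simp)).mul (ih fun j hj => h j (by simp [hj]))).congr_val ?_
    rw [Finset.erase_insert hi, Finset.mul_sum, mul_comm (d i)]
    congr 1
    refine Finset.sum_congr rfl fun j hj => ?_
    rw [Finset.erase_insert_of_ne (by rintro rfl; exact hi hj),
      Finset.prod_insert (by simp [hi]), mul_assoc]

/-- Jacobi's formula. -/
lemma HasWirtMat.det {A : E → Matrix n n ℂ} {D : Matrix n n ℂ} (hA : HasWirtMat A x X Y D) :
    HasWirt (fun y => (A y).det) x X Y ((A x).adjugate * D).trace := by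
  simp only [det_apply', trace, diag]
  refine (HasWirt.sum fun σ _ => (hasWirt_const ((Equiv.Perm.sign σ : ℤ) : ℂ)).mul
    (hasWirt_prod Finset.univ fun i _ => hA (σ i) i)).congr_val ?_
  simp only [zero_mul, zero_add, Finset.mul_sum]
  rw [Finset.sum_comm]
  refine Finset.sum_congr rfl fun i _ => ?_
  rw [show ((A x).adjugate * D) i i = ((A x).adjugate *ᵥ fun j => D j i) i from rfl,
    ← cramer_eq_adjugate_mulVec, cramer_apply, det_apply']
  refine Finset.sum_congr rfl fun σ _ => ?_
  rw [← Finset.mul_prod_erase Finset.univ _ (Finset.mem_univ i), mul_comm (∏ j ∈ _, _)]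
  simp only [updateCol_self]
  congr 2
  exact Finset.prod_congr rfl fun j hj => by rw [updateCol_ne (Finset.ne_of_mem_erase hj)]

omit [NormedSpace ℂ E] in
lemma contDiffAt_det {A : E → Matrix n n ℂ} (hA : ∀ i j, ContDiffAt ℝ 1 (fun y => A y i j) x) :
    ContDiffAt ℝ 1 (fun y => (A y).det) x := by
  simp only [det_apply']
  exact ContDiffAt.sum fun σ _ => contDiffAt_const.mul (contDiffAt_prod fun i _ => hA _ _)

omit [NormedSpace ℂ E] in
lemma contDiffAt_inv {A : E → Matrix n n ℂ} (hA : ∀ i j, ContDiffAt ℝ 1 (fun y => A y i j) x)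
    (h : (A x).det ≠ 0) (i j : n) : ContDiffAt ℝ 1 (fun y => (A y)⁻¹ i j) x := by
  have hinv : (fun y => (A y)⁻¹ i j)
      = fun y => ((A y).det)⁻¹ * ((A y).updateRow j (Pi.single i 1)).det := by
    funext y
    rw [Matrix.inv_def, Matrix.smul_apply, smul_eq_mul, Ring.inverse_eq_inv', adjugate_apply]
  rw [hinv]
  refine ((contDiffAt_det hA).inv h).mul (contDiffAt_det fun k l => ?_)
  by_cases hk : k = j
  · subst hk; simp only [updateRow_self]; exact contDiffAt_const
  · simp only [updateRow_ne hk]; exact hA k l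

/-- The inverse is differentiable by Cramer's rule; its derivative is read off from `A A⁻¹ = 1`. -/
lemma HasWirtMat.inv {A : E → Matrix n n ℂ} {D : Matrix n n ℂ} (hA : HasWirtMat A x X Y D)
    (hAC : ∀ i j, ContDiffAt ℝ 1 (fun y => A y i j) x) (h : (A x).det ≠ 0) :
    HasWirtMat (fun y => (A y)⁻¹) x X Y (-((A x)⁻¹ * D * (A x)⁻¹)) := by
  let D' : Matrix n n ℂ := of fun i j => wirt (fderiv ℝ (fun y => (A y)⁻¹ i j) x) X Y
  have hD' : HasWirtMat (fun y => (A y)⁻¹) x X Y D' := fun i j =>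
    hasWirt_fderiv ((contDiffAt_inv hAC h i j).differentiableAt one_ne_zero)
  have hev : ∀ᶠ y in 𝓝 x, A y * (A y)⁻¹ = 1 :=
    ((contDiffAt_det hAC).continuousAt.eventually_ne h).mono fun y hy =>
      mul_nonsing_inv _ hy.isUnit
  have h0 : D * (A x)⁻¹ + A x * D' = 0 := by
    ext i j
    refine (hA.mul hD' i j).unique ((hasWirt_const ((1 : Matrix n n ℂ) i j)).congr ?_)
    exact hev.mono fun y hy => congrFun (congrFun hy i) j
  have h1 : D' = -((A x)⁻¹ * D * (A x)⁻¹) := by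
    have h2 := congrArg ((A x)⁻¹ * ·) h0
    simp only [mul_add, mul_zero, ← mul_assoc, nonsing_inv_mul _ h.isUnit, one_mul] at h2
    exact eq_neg_of_add_eq_zero_right h2
  exact h1 ▸ hD'

end MatrixCalculus

variable {n : ℕ}

/-! ### The Siegel-Jacobi ball -/

lemma transpose_wMat (x : Coord n) : (wMat x)ᵀ = wMat x := by
  ext i j
  simp [wMat, Sym2.eq_swap]

lemma transpose_wBar (x : Coord n) : (wBar x)ᵀ = wBar x := by
  ext i j
  simp [wBar, wMat, Sym2.eq_swap]

lemma conjTranspose_wMat (x : Coord n) : (wMat x)ᴴ = wBar x := by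
  rw [← transpose_wBar]
  rfl

lemma isHermitian_one_sub (x : Coord n) : (1 - wMat x * wBar x).IsHermitian := by
  rw [IsHermitian, conjTranspose_sub, conjTranspose_one, conjTranspose_mul, conjTranspose_wMat,
    ← conjTranspose_wMat, conjTranspose_conjTranspose]

lemma norm_wMat_le_one {x : Coord n} (hx : (1 - wMat x * wBar x).PosSemidef) (i j : Fin n) :
    ‖wMat x i j‖ ≤ 1 := by
  have h := hx.diag_nonneg (i := i)
  have h1 : (wMat x * wBar x) i i = ((∑ l, ‖wMat x i l‖ ^ 2 : ℝ) : ℂ) := by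
    rw [mul_apply, ofReal_sum]
    refine Finset.sum_congr rfl fun l _ => ?_
    rw [show wBar x l i = starRingEnd ℂ (wMat x i l) by
      rw [← conjTranspose_wMat]; rfl, mul_conj, normSq_eq_norm_sq]
  rw [Matrix.sub_apply, one_apply_eq, h1, ← ofReal_one, ← ofReal_sub, zero_le_real,
    sub_nonneg] at h
  have h2 : ‖wMat x i j‖ ^ 2 ≤ ∑ l, ‖wMat x i l‖ ^ 2 :=
    Finset.single_le_sum (f := fun l => ‖wMat x i l‖ ^ 2) (fun l _ => by positivity)
      (Finset.mem_univ j)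
  exact (sq_le_one_iff₀ (norm_nonneg _)).1 (h2.trans h)

lemma continuous_one_sub : Continuous fun x : Coord n => 1 - wMat x * wBar x := by
  have h1 : Continuous fun x : Coord n => wMat x :=
    continuous_matrix fun i j => (continuous_apply s(i, j)).comp continuous_snd
  have h2 : Continuous fun x : Coord n => wBar x := h1.matrix_map continuous_conj
  exact continuous_const.sub (h1.matrix_mul h2)

lemma isOpen_ball : IsOpen (ball n) := by
  rw [isOpen_iff_mem_nhds]
  intro x₀ hx₀
  have hq : Continuous fun p : Coord n × (Fin n → ℂ) =>
      (star p.2 ⬝ᵥ (1 - wMat p.1 * wBar p.1) *ᵥ p.2).re :=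
    continuous_re.comp (continuous_snd.star.dotProduct
      ((continuous_one_sub.comp continuous_fst).matrix_mulVec continuous_snd))
  have hK := (isCompact_sphere (0 : Fin n → ℂ) 1).eventually_forall_of_forall_eventually
    (x₀ := x₀) (P := fun x v => 0 < (star v ⬝ᵥ (1 - wMat x * wBar x) *ᵥ v).re) fun v hv => by
      have hv0 : v ≠ 0 := by rintro rfl; simp at hv
      exact hq.continuousAt.eventually_mem
        (isOpen_Ioi.mem_nhds (lt_def.1 (hx₀.dotProduct_mulVec_pos hv0)).1)
  refine hK.mono fun x hx => PosDef.of_dotProduct_mulVec_pos (isHermitian_one_sub x) fun v hv => ?_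
  have hn : 0 < ‖v‖ := norm_pos_iff.2 hv
  have h1 := hx ((‖v‖⁻¹ : ℂ) • v) (by simp [norm_smul, hn.ne'])
  rw [star_smul, mulVec_smul, dotProduct_smul, smul_dotProduct, smul_eq_mul, smul_eq_mul,
    ← mul_assoc, ← ofReal_inv, RCLike.star_def, conj_ofReal, ← ofReal_mul, re_ofReal_mul] at h1
  refine lt_def.2 ⟨?_, ((isHermitian_one_sub x).im_star_dotProduct_mulVec_self v).symm⟩
  exact (mul_pos_iff_of_pos_left (by positivity)).1 h1

lemma det_ne_zero {x : Coord n} (hx : x ∈ ball n) : (1 - wMat x * wBar x).det ≠ 0 :=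
  (PosDef.det_pos hx).ne'

lemma ofReal_det_re (x : Coord n) :
    ((1 - wMat x * wBar x).det.re : ℂ) = (1 - wMat x * wBar x).det := by
  rw [← conj_eq_iff_re, ← RCLike.star_def, ← det_conjTranspose, isHermitian_one_sub x]

lemma det_re_pos {x : Coord n} (hx : x ∈ ball n) : 0 < (1 - wMat x * wBar x).det.re :=
  (lt_def.1 (PosDef.det_pos hx)).1

/-- A function on the ball that tends to `0` at the boundary and at infinity. -/
def exhaust (x : Coord n) : ℝ := (1 - wMat x * wBar x).det.re * (1 + ∑ i, normSq (x.1 i))⁻¹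

lemma one_add_sum_normSq_pos (x : Coord n) : 0 < 1 + ∑ i, normSq (x.1 i) :=
  add_pos_of_pos_of_nonneg one_pos (Finset.sum_nonneg fun _ _ => normSq_nonneg _)

lemma exhaust_pos {x : Coord n} (hx : x ∈ ball n) : 0 < exhaust x :=
  mul_pos (det_re_pos hx) (inv_pos.2 (one_add_sum_normSq_pos x))

lemma norm_sq_le_sum_normSq (x : Coord n) : ‖x.1‖ ^ 2 ≤ ∑ i, normSq (x.1 i) := by
  have h0 : 0 ≤ ∑ i, normSq (x.1 i) := Finset.sum_nonneg fun _ _ => normSq_nonneg _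
  rw [← Real.le_sqrt (norm_nonneg _) h0, pi_norm_le_iff_of_nonneg (Real.sqrt_nonneg _)]
  intro i
  rw [Real.le_sqrt (norm_nonneg _) h0, ← normSq_eq_norm_sq]
  exact Finset.single_le_sum (f := fun i => normSq (x.1 i)) (fun _ _ => normSq_nonneg _)
    (Finset.mem_univ i)

lemma isCompact_le_exhaust {ε : ℝ} (hε : 0 < ε) :
    IsCompact {x : Coord n | x ∈ ball n ∧ ε ≤ exhaust x} := by
  have hdet : Continuous fun x : Coord n => (1 - wMat x * wBar x).det.re :=
    continuous_re.comp continuous_one_sub.matrix_det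
  have hsum : Continuous fun x : Coord n => 1 + ∑ i, normSq (x.1 i) := by
    have := continuous_normSq
    fun_prop
  have hset : {x : Coord n | x ∈ ball n ∧ ε ≤ exhaust x}
      = {x | (∀ v : Fin n → ℂ, 0 ≤ star v ⬝ᵥ (1 - wMat x * wBar x) *ᵥ v) ∧
          ε * (1 + ∑ i, normSq (x.1 i)) ≤ (1 - wMat x * wBar x).det.re} := by
    ext x
    have hle : ε ≤ exhaust x ↔ ε * (1 + ∑ i, normSq (x.1 i)) ≤ (1 - wMat x * wBar x).det.re := by
      rw [exhaust, ← div_eq_mul_inv, le_div_iff₀ (one_add_sum_normSq_pos x)]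
    simp only [Set.mem_ofPred_eq, hle]
    refine and_congr_left fun h => ?_
    have hd : (1 - wMat x * wBar x).det ≠ 0 := fun h0 => by
      rw [h0, zero_re] at h
      exact absurd h (not_le.2 (mul_pos hε (one_add_sum_normSq_pos x)))
    refine ⟨fun h => h.posSemidef.dotProduct_mulVec_nonneg, fun h => ?_⟩
    exact (PosSemidef.posDef_iff_det_ne_zero
      (.of_dotProduct_mulVec_nonneg (isHermitian_one_sub x) h)).2 hd
  refine Metric.isCompact_of_isClosed_isBounded ?_ ?_
  · rw [hset, Set.ofPred_and]
    refine IsClosed.inter ?_ (isClosed_le (continuous_const.mul hsum) hdet)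
    rw [Set.ofPred_forall]
    exact isClosed_iInter fun v => isClosed_le continuous_const
      (continuous_const.dotProduct (continuous_one_sub.matrix_mulVec continuous_const))
  · -- the determinant is bounded on bounded sets of symmetric matrices
    obtain ⟨D, hD⟩ := (isCompact_closedBall (0 : Coord n) 1).bddAbove_image hdet.continuousOn
    refine (Metric.isBounded_closedBall (x := (0 : Coord n)) (r := 1 + D / ε)).subset ?_
    rintro x ⟨hx, hεx⟩
    have hw : ‖x.2‖ ≤ 1 := (pi_norm_le_iff_of_nonneg zero_le_one).2 fun s => by
      induction s using Sym2.ind with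
      | _ i j => exact norm_wMat_le_one hx.posSemidef i j
    have hx0 : ((0, x.2) : Coord n) ∈ Metric.closedBall 0 1 := by simpa [Prod.norm_def] using hw
    have hdD : (1 - wMat x * wBar x).det.re ≤ D := hD ⟨(0, x.2), hx0, rfl⟩
    rw [exhaust, ← div_eq_mul_inv, le_div_iff₀ (one_add_sum_normSq_pos x)] at hεx
    have h1 : ‖x.1‖ ^ 2 ≤ D / ε := by
      rw [le_div_iff₀ hε]
      nlinarith [norm_sq_le_sum_normSq x]
    have h2 : 0 ≤ D / ε := (sq_nonneg _).trans h1
    rw [mem_closedBall_zero_iff, Prod.norm_def]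
    exact max_le (by nlinarith [norm_nonneg x.1]) (by linarith)

/-! ### Wirtinger derivatives of the coordinates -/

/-- The coordinate `zᵢ` as a linear form. -/
def zCLM (i : Fin n) : Coord n →L[ℂ] ℂ :=
  (ContinuousLinearMap.proj i).comp (ContinuousLinearMap.fst ℂ _ _)

/-- The coordinate `w_{ij}` as a linear form. -/
def wCLM (i j : Fin n) : Coord n →L[ℂ] ℂ :=
  (ContinuousLinearMap.proj s(i, j)).comp (ContinuousLinearMap.snd ℂ _ _)

section Coordinates

variable (x X Y : Coord n)

lemma hasWirtVec_z : HasWirtVec (fun y : Coord n => y.1) x X Y (-Y.1) := fun i =>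
  hasWirt_of_hasFDerivAt (zCLM i).hasFDerivAt

lemma hasWirtVec_zBar : HasWirtVec (fun y : Coord n => zBar y) x X Y (zBar X) := fun i =>
  hasWirt_conj_of_hasFDerivAt (zCLM i).hasFDerivAt

lemma hasWirtMat_wMat : HasWirtMat (fun y : Coord n => wMat y) x X Y (-wMat Y) := fun i j =>
  hasWirt_of_hasFDerivAt (wCLM i j).hasFDerivAt

lemma hasWirtMat_wBar : HasWirtMat (fun y : Coord n => wBar y) x X Y (wBar X) := fun i j =>
  hasWirt_conj_of_hasFDerivAt (wCLM i j).hasFDerivAt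

lemma hasWirtMat_one_sub : HasWirtMat (fun y : Coord n => 1 - wMat y * wBar y) x X Y
    (wMat Y * wBar x - wMat x * wBar X) := fun i j => by
  refine ((hasWirt_const ((1 : Matrix (Fin n) (Fin n) ℂ) i j)).sub
    ((hasWirtMat_wMat x X Y).mul (hasWirtMat_wBar x X Y) i j)).congr_val ?_
  simp [sub_eq_add_neg, add_comm]

variable {x X Y}

lemma contDiff_wMat (i j : Fin n) : ContDiff ℝ 1 fun y : Coord n => wMat y i j :=
  (wCLM i j).contDiff.restrict_scalars ℝ

lemma contDiff_wBar (i j : Fin n) : ContDiff ℝ 1 fun y : Coord n => wBar y i j :=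
  conjCLE.contDiff.comp (contDiff_wMat i j)

lemma contDiff_z (i : Fin n) : ContDiff ℝ 1 fun y : Coord n => y.1 i :=
  (zCLM i).contDiff.restrict_scalars ℝ

lemma contDiff_zBar (i : Fin n) : ContDiff ℝ 1 fun y : Coord n => zBar y i :=
  conjCLE.contDiff.comp (contDiff_z i)

lemma contDiff_one_sub (i j : Fin n) :
    ContDiff ℝ 1 fun y : Coord n => (1 - wMat y * wBar y) i j := by
  simp only [Matrix.sub_apply, mul_apply]
  exact contDiff_const.sub (ContDiff.sum fun l _ => (contDiff_wMat i l).mul (contDiff_wBar l j))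

lemma contDiffAt_mMat (hx : x ∈ ball n) (i j : Fin n) :
    ContDiffAt ℝ 1 (fun y : Coord n => mMat y i j) x :=
  contDiffAt_inv (fun i j => (contDiff_one_sub i j).contDiffAt) (det_ne_zero hx) i j

lemma contDiffAt_potF (hx : x ∈ ball n) : ContDiffAt ℝ 1 (fun y : Coord n => potF y) x := by
  have hm := contDiffAt_mMat hx
  have hw i j := (contDiff_wMat (n := n) i j).contDiffAt (x := x)
  have hwb i j := (contDiff_wBar (n := n) i j).contDiffAt (x := x)
  have hz i := (contDiff_z (n := n) i).contDiffAt (x := x)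
  have hzb i := (contDiff_zBar (n := n) i).contDiffAt (x := x)
  simp only [potF, dotProduct, mulVec, mul_apply]
  fun_prop

lemma contDiffAt_det_re : ContDiffAt ℝ 1 (fun y : Coord n => (1 - wMat y * wBar y).det.re) x :=
  reCLM.contDiff.contDiffAt.comp x
    (contDiffAt_det fun i j => (contDiff_one_sub i j).contDiffAt)

lemma contDiffOn_density (k : ℝ) : ContDiffOn ℝ 1 (density (n := n) k) (ball n) := fun x hx =>
  ((contDiffAt_det_re.rpow_const_of_ne (det_re_pos hx).ne').mul
    (Real.contDiff_exp.contDiffAt.comp x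
      (reCLM.contDiff.contDiffAt.comp x (contDiffAt_potF hx)).neg)).contDiffWithinAt

lemma contDiffOn_exhaust : ContDiffOn ℝ 1 (exhaust (n := n)) (ball n) := fun x _ => by
  refine (contDiffAt_det_re.mul (ContDiffAt.inv ?_
    (one_add_sum_normSq_pos x).ne')).contDiffWithinAt
  refine contDiffAt_const.add (ContDiffAt.sum fun i _ => ?_)
  have h (y : Coord n) : normSq (y.1 i) = reCLM (y.1 i * zBar y i) := by
    simp [zBar, mul_conj]
  simp only [h]
  exact reCLM.contDiff.contDiffAt.comp x ((contDiff_z i).mul (contDiff_zBar i)).contDiffAt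

end Coordinates

/-! ### Logarithmic derivatives of the density and of the exhaustion function -/

section Relations

variable {x : Coord n}

lemma mMat_mul_wMat (hx : x ∈ ball n) : mMat x * wMat x = wMat x * (mMat x)ᵀ := by
  have hu := (det_ne_zero hx).isUnit
  have h1 : (1 - wMat x * wBar x) * wMat x = wMat x * (1 - wMat x * wBar x)ᵀ := by
    simp only [transpose_sub, transpose_one, transpose_mul, transpose_wMat, transpose_wBar]
    noncomm_ring
  rw [mMat, transpose_nonsing_inv]
  calc _ = (1 - wMat x * wBar x)⁻¹ * (wMat x * (1 - wMat x * wBar x)ᵀ)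
          * ((1 - wMat x * wBar x)ᵀ)⁻¹ := by
        rw [← mul_assoc, mul_nonsing_inv_cancel_right _ _ (by rwa [det_transpose])]
    _ = _ := by rw [← h1, nonsing_inv_mul_cancel_left _ _ hu]

lemma wMat_mul_wBar_mul_mMat (hx : x ∈ ball n) :
    wMat x * (wBar x * mMat x) = mMat x - 1 := by
  have h := mul_nonsing_inv _ (det_ne_zero hx).isUnit
  rw [← mMat, Matrix.sub_mul, Matrix.one_mul, mul_assoc] at h
  rw [← h]; abel

lemma mMat_mul_wMat_mul_wBar (hx : x ∈ ball n) :
    mMat x * (wMat x * wBar x) = mMat x - 1 := by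
  have h := nonsing_inv_mul _ (det_ne_zero hx).isUnit
  rw [← mMat, Matrix.mul_sub, Matrix.mul_one] at h
  rw [← h]; abel

lemma wBar_mul_wMat_mul_mMat_transpose (hx : x ∈ ball n) :
    wBar x * (wMat x * (mMat x)ᵀ) = (mMat x)ᵀ - 1 := by
  have h := congrArg transpose (mMat_mul_wMat_mul_wBar hx)
  simpa only [transpose_mul, transpose_sub, transpose_one, transpose_wMat, transpose_wBar,
    mul_assoc] using h

lemma wBar_mul_mMat (hx : x ∈ ball n) : wBar x * mMat x = (mMat x)ᵀ * wBar x := by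
  have h1 := wBar_mul_wMat_mul_mMat_transpose hx
  rw [← mMat_mul_wMat hx] at h1
  calc wBar x * mMat x = wBar x * (mMat x * (wMat x * wBar x)) + wBar x := by
        rw [mMat_mul_wMat_mul_wBar hx]; noncomm_ring
    _ = (wBar x * (mMat x * wMat x)) * wBar x + wBar x := by noncomm_ring
    _ = _ := by rw [h1]; noncomm_ring

lemma conjTranspose_mMat (x : Coord n) : (mMat x)ᴴ = mMat x := by
  rw [mMat, conjTranspose_nonsing_inv, isHermitian_one_sub]

/-- `η = M (z + W z̄)`, the derivative of `F` in `z̄`. -/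
def etaVec (x : Coord n) : Fin n → ℂ := mMat x *ᵥ x.1 + wMat x *ᵥ (mMat x)ᵀ *ᵥ zBar x

/-- `η̄`, the derivative of `F` in `z`. -/
def etaBar (x : Coord n) : Fin n → ℂ := (mMat x)ᵀ *ᵥ zBar x + wBar x *ᵥ mMat x *ᵥ x.1

lemma wMat_mulVec_etaBar (hx : x ∈ ball n) : wMat x *ᵥ etaBar x = etaVec x - x.1 := by
  have h := congrArg (· *ᵥ x.1) (wMat_mul_wBar_mul_mMat hx)
  simp only [← mulVec_mulVec, sub_mulVec, one_mulVec] at h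
  rw [etaBar, etaVec, mulVec_add, h]; abel

lemma wBar_mulVec_etaVec (hx : x ∈ ball n) : wBar x *ᵥ etaVec x = etaBar x - zBar x := by
  have h := congrArg (· *ᵥ zBar x) (wBar_mul_wMat_mul_mMat_transpose hx)
  simp only [← mulVec_mulVec, sub_mulVec, one_mulVec] at h
  rw [etaBar, etaVec, mulVec_add, h]; abel

lemma potF_conj (x : Coord n) : starRingEnd ℂ (potF x) = potF x := by
  have hz : star x.1 = zBar x := rfl
  have hzb : star (zBar x) = x.1 := by rw [← hz, star_star]
  have h1 : star (zBar x ⬝ᵥ mMat x *ᵥ x.1) = zBar x ⬝ᵥ mMat x *ᵥ x.1 := by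
    rw [← star_dotProduct_star, star_mulVec, conjTranspose_mMat, hz, hzb, ← dotProduct_mulVec]
  have h2 : star (x.1 ⬝ᵥ (wBar x * mMat x) *ᵥ x.1)
      = zBar x ⬝ᵥ (mMat x * wMat x) *ᵥ zBar x := by
    rw [← star_dotProduct_star, star_mulVec, conjTranspose_mul, conjTranspose_mMat, hz,
      ← conjTranspose_wMat, conjTranspose_conjTranspose, ← dotProduct_mulVec]
  have h3 : star (zBar x ⬝ᵥ (mMat x * wMat x) *ᵥ zBar x)
      = x.1 ⬝ᵥ (wBar x * mMat x) *ᵥ x.1 := by rw [← h2, star_star]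
  rw [potF, ← RCLike.star_def, star_div₀, star_add, star_add, star_mul', h1, h2, h3]
  simp only [star_ofNat]
  ring

end Relations

section LogDerivative

variable {x X Y : Coord n}

lemma dotProduct_mulVec_comm_transpose {m : Type*} [Fintype m] (A : Matrix m m ℂ) (u v : m → ℂ) :
    u ⬝ᵥ A *ᵥ v = (Aᵀ *ᵥ u) ⬝ᵥ v := by
  rw [dotProduct_mulVec, mulVec_transpose]

/-- The derivatives of `F` are `∂F/∂z̄ = η`, `∂F/∂z = η̄`, `∂F/∂W̄ = η ηᵗ / 2`,
`∂F/∂W = η̄ η̄ᵗ / 2`. -/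
lemma hasWirt_potF (hx : x ∈ ball n) : HasWirt (fun y : Coord n => potF y) x X Y
    (zBar X ⬝ᵥ etaVec x - Y.1 ⬝ᵥ etaBar x
      + (etaVec x ⬝ᵥ wBar X *ᵥ etaVec x - etaBar x ⬝ᵥ wMat Y *ᵥ etaBar x) / 2) := by
  have hM : HasWirtMat (fun y : Coord n => mMat y) x X Y _ :=
    (hasWirtMat_one_sub x X Y).inv (fun i j => (contDiff_one_sub i j).contDiffAt) (det_ne_zero hx)
  have hW := hasWirtMat_wMat x X Y
  have hB := hasWirtMat_wBar x X Y
  have hz := hasWirtVec_z x X Y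
  have hzb := hasWirtVec_zBar x X Y
  have key := ((((hasWirt_const (2 : ℂ)).mul (hzb.dotProduct (hM.mulVec hz))).add
    (hz.dotProduct ((hB.mul hM).mulVec hz))).add
    (hzb.dotProduct ((hM.mul hW).mulVec hzb))).mul (hasWirt_const (1 / 2 : ℂ))
  refine (key.congr (Eventually.of_forall fun y => ?_)).congr_val ?_
  · rw [potF, div_eq_mul_one_div]
  rw [← mMat]
  set W := wMat x
  set B := wBar x
  set M := mMat x
  set U := wMat Y
  set V := wBar X
  have e1 : M * W = W * Mᵀ := mMat_mul_wMat hx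
  have e2 : B * M = Mᵀ * B := wBar_mul_mMat hx
  have hWt : Wᵀ = W := transpose_wMat x
  have hBt : Bᵀ = B := transpose_wBar x
  have hUt : Uᵀ = U := transpose_wMat Y
  have hVt : Vᵀ = V := transpose_wBar X
  set z := x.1
  set c := zBar x
  -- the vectors `P = M z`, `R = Mᵗ z̄`, in terms of which everything is expressed
  set P := M *ᵥ z with hP
  set R := Mᵀ *ᵥ c with hR
  have f1 : W *ᵥ B *ᵥ P = P - z := by
    have h := congrArg (· *ᵥ z) (wMat_mul_wBar_mul_mMat hx)
    simpa only [← mulVec_mulVec, sub_mulVec, one_mulVec] using h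
  have f2 : B *ᵥ W *ᵥ R = R - c := by
    have h := congrArg (· *ᵥ c) (wBar_mul_wMat_mul_mMat_transpose hx)
    simpa only [← mulVec_mulVec, sub_mulVec, one_mulVec] using h
  have f3 : M *ᵥ W *ᵥ c = W *ᵥ R := by
    rw [mulVec_mulVec, e1, ← mulVec_mulVec]
  have f4 : Mᵀ *ᵥ B *ᵥ z = B *ᵥ P := by
    rw [mulVec_mulVec, ← e2, ← mulVec_mulVec]
  have g1 (v : Fin n → ℂ) : c ⬝ᵥ M *ᵥ v = R ⬝ᵥ v := dotProduct_mulVec_comm_transpose M c v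
  have g2 (u v : Fin n → ℂ) : u ⬝ᵥ W *ᵥ v = (W *ᵥ u) ⬝ᵥ v := by
    rw [dotProduct_mulVec_comm_transpose, hWt]
  have g3 (v : Fin n → ℂ) : z ⬝ᵥ B *ᵥ M *ᵥ v = (B *ᵥ P) ⬝ᵥ v := by
    rw [mulVec_mulVec, dotProduct_mulVec_comm_transpose, transpose_mul, hBt, ← mulVec_mulVec, f4]
  have c1 : (B *ᵥ P) ⬝ᵥ U *ᵥ R = R ⬝ᵥ U *ᵥ B *ᵥ P := by
    rw [dotProduct_mulVec_comm_transpose, hUt, dotProduct_comm]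
  have c2 : (W *ᵥ R) ⬝ᵥ V *ᵥ P = P ⬝ᵥ V *ᵥ W *ᵥ R := by
    rw [dotProduct_mulVec_comm_transpose, hVt, dotProduct_comm]
  have c3 := dotProduct_comm R Y.1
  have c4 := dotProduct_comm (B *ᵥ P) Y.1
  have c5 : (W *ᵥ zBar X) ⬝ᵥ R = (W *ᵥ R) ⬝ᵥ zBar X := by rw [← g2, dotProduct_comm]
  have hη : etaVec x = P + W *ᵥ R := rfl
  have hη' : etaBar x = R + B *ᵥ P := rfl
  rw [hη, hη']
  simp only [add_mulVec, sub_mulVec, neg_mulVec, mulVec_neg, Matrix.mul_sub,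
    Matrix.sub_mul, Matrix.mul_neg, Matrix.neg_mul, ← mulVec_mulVec, mulVec_add]
  simp only [← hP, f3, f2, dotProduct_add, dotProduct_sub, add_dotProduct,
    dotProduct_neg, neg_dotProduct, mulVec_sub, g1, g3]
  simp only [g2, f1, sub_dotProduct]
  linear_combination (c1 + c2 - c4 - c5) / 2 - c3

/-- The logarithmic derivative of `det (1 - W W̄)` is `tr (M d(1 - W W̄))`. -/
lemma hasWirt_det_re (hx : x ∈ ball n) :
    HasWirt (fun y : Coord n => ((1 - wMat y * wBar y).det.re : ℂ)) x X Y
      ((mMat x * (wMat Y * wBar x - wMat x * wBar X)).trace * (1 - wMat x * wBar x).det.re) := by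
  refine ((hasWirtMat_one_sub x X Y).det.congr
    (Eventually.of_forall ofReal_det_re)).congr_val ?_
  rw [ofReal_det_re, mMat, Matrix.inv_def, Ring.inverse_eq_inv', Matrix.smul_mul, trace_smul,
    smul_eq_mul]
  field_simp [det_ne_zero hx]

lemma hasWirt_density (k : ℝ) (hx : x ∈ ball n) {l κ : ℂ}
    (hl : (mMat x * (wMat Y * wBar x - wMat x * wBar X)).trace = l)
    (hκ : HasWirt (fun y : Coord n => potF y) x X Y κ) :
    HasWirt (fun y : Coord n => (density k y : ℂ)) x X Y
      (((k / 2 - n - 2) * l - κ) * density k x) := by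
  have hd := det_re_pos hx
  have h1 := ((hasWirt_det_re (X := X) (Y := Y) hx).ofReal_comp
    (Real.hasDerivAt_rpow_const (p := k / 2 - n - 2) (Or.inl hd.ne')))
  have hF : HasWirt (fun y : Coord n => ((potF y).re : ℂ)) x X Y κ :=
    hκ.congr (Eventually.of_forall fun y => conj_eq_iff_re.1 (potF_conj y))
  have h2 := hF.ofReal_comp (ψ := fun t => Real.exp (-t))
    ((hasDerivAt_neg (potF x).re).exp)
  have h3 := h1.mul h2
  simp only [← ofReal_mul] at h3
  refine h3.congr_val ?_
  rw [hl, Real.rpow_sub_one hd.ne', density]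
  have hd' : ((1 - wMat x * wBar x).det.re : ℂ) ≠ 0 := ofReal_ne_zero.2 hd.ne'
  push_cast
  field_simp
  ring

lemma hasWirt_exhaust (hx : x ∈ ball n) {l : ℂ}
    (hl : (mMat x * (wMat Y * wBar x - wMat x * wBar X)).trace = l) :
    HasWirt (fun y : Coord n => (exhaust y : ℂ)) x X Y
      ((l - (x.1 ⬝ᵥ zBar X - Y.1 ⬝ᵥ zBar x) / (1 + ∑ i, normSq (x.1 i) : ℝ)) * exhaust x) := by
  have hs := one_add_sum_normSq_pos x
  have h1 : HasWirt (fun y : Coord n => ((1 + ∑ i, normSq (y.1 i) : ℝ) : ℂ)) x X Y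
      (x.1 ⬝ᵥ zBar X - Y.1 ⬝ᵥ zBar x) := by
    refine (((hasWirt_const 1).add ((hasWirtVec_z x X Y).dotProduct
      (hasWirtVec_zBar x X Y))).congr (Eventually.of_forall fun y => ?_)).congr_val ?_
    · simp [dotProduct, zBar, mul_conj]
    · rw [neg_dotProduct]; ring
  have h2 := (hasWirt_det_re (X := X) (Y := Y) hx).mul (h1.ofReal_comp (hasDerivAt_inv hs.ne'))
  simp only [← ofReal_mul] at h2
  refine h2.congr_val ?_
  rw [hl, exhaust]
  have hs' : ((1 + ∑ i, normSq (x.1 i) : ℝ) : ℂ) ≠ 0 := ofReal_ne_zero.2 hs.ne'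
  push_cast at hs' ⊢
  field_simp
  ring

end LogDerivative

/-! ### First-order operators on the Siegel-Jacobi ball -/

/-- The operator `c + ∑ aᵢ ∂/∂zᵢ + ∑ b_{ij} ∇_{ij}`. -/
def firstOrder (c : Coord n → ℂ) (a : Coord n → Fin n → ℂ)
    (b : Coord n → Matrix (Fin n) (Fin n) ℂ) (f : Coord n → ℂ) (x : Coord n) : ℂ :=
  c x * f x + ∑ i, a x i * dz i f x + ∑ i, ∑ j, b x i j * nabla i j f x

/-- The divergence of the vector field `∑ aᵢ ∂/∂zᵢ + ∑ b_{ij} ∇_{ij}`. -/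
def divergence (a : Coord n → Fin n → ℂ) (b : Coord n → Matrix (Fin n) (Fin n) ℂ)
    (x : Coord n) : ℂ :=
  ∑ i, dz i (fun y => a y i) x + ∑ i, ∑ j, nabla i j (fun y => b y i j) x

/-- The constant vector fields `∂/∂zᵢ` and `∇_{ij}`. They span, but the `∇_{ij}` with `i ≠ j` are
listed twice. -/
def dir : Fin n ⊕ Fin n × Fin n → Coord n :=
  Sum.elim (fun i => (Pi.single i 1, 0))
    (fun p => (0, ((1 + if p.1 = p.2 then 1 else 0) / 2 : ℂ) • Pi.single s(p.1, p.2) 1))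

/-- The coefficients of `∑ aᵢ ∂/∂zᵢ + ∑ b_{ij} ∇_{ij}` with respect to `dir`. -/
def coeff (a : Coord n → Fin n → ℂ) (b : Coord n → Matrix (Fin n) (Fin n) ℂ) :
    Fin n ⊕ Fin n × Fin n → Coord n → ℂ :=
  Sum.elim (fun i x => a x i) (fun p x => b x p.1 p.2)

lemma fderiv_dir_inl (f : Coord n → ℂ) (x : Coord n) (i : Fin n) :
    fderiv ℂ f x (dir (Sum.inl i)) = dz i f x := rfl

lemma fderiv_dir_inr (f : Coord n → ℂ) (x : Coord n) (p : Fin n × Fin n) :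
    fderiv ℂ f x (dir (Sum.inr p)) = nabla p.1 p.2 f x := by
  have h : dir (Sum.inr p) = ((1 + if p.1 = p.2 then 1 else 0) / 2 : ℂ) •
      ((0, Pi.single s(p.1, p.2) 1) : Coord n) := by
    simp [dir]
  rw [h, map_smul, smul_eq_mul, nabla, dw]

lemma firstOrder_eq (c : Coord n → ℂ) (a : Coord n → Fin n → ℂ)
    (b : Coord n → Matrix (Fin n) (Fin n) ℂ) (f : Coord n → ℂ) (x : Coord n) :
    firstOrder c a b f x = c x * f x + fderiv ℂ f x (∑ t, coeff a b t x • dir t) := by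
  simp only [map_add, map_sum, map_smul, Fintype.sum_sum_type, Fintype.sum_prod_type, fderiv_dir_inl,
    fderiv_dir_inr, smul_eq_mul, coeff, Sum.elim_inl, Sum.elim_inr, firstOrder, add_assoc]

lemma divergence_eq (a : Coord n → Fin n → ℂ) (b : Coord n → Matrix (Fin n) (Fin n) ℂ)
    (x : Coord n) : ∑ t, fderiv ℂ (coeff a b t) x (dir t) = divergence a b x := by
  simp only [Fintype.sum_sum_type, Fintype.sum_prod_type, fderiv_dir_inl, fderiv_dir_inr]
  rfl

lemma sum_coeff_smul_dir_fst (a : Coord n → Fin n → ℂ) (b : Coord n → Matrix (Fin n) (Fin n) ℂ)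
    (x : Coord n) : (∑ t, coeff a b t x • dir t).1 = a x := by
  ext i
  simp [coeff, dir, Prod.fst_sum, Pi.single_apply]

lemma wMat_dir_inr (p : Fin n × Fin n) (i j : Fin n) : wMat (dir (Sum.inr p)) i j
    = ((if p.1 = i ∧ p.2 = j then 1 else 0) + if p.1 = j ∧ p.2 = i then 1 else 0) / 2 := by
  obtain ⟨k, l⟩ := p
  simp only [wMat, dir, Sum.elim_inr, of_apply, Pi.smul_apply, Pi.single_apply, smul_eq_mul,
    Sym2.eq_iff]
  grind

lemma wMat_sum_coeff_smul_dir (a : Coord n → Fin n → ℂ)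
    (b : Coord n → Matrix (Fin n) (Fin n) ℂ) (x : Coord n) :
    wMat (∑ t, coeff a b t x • dir t) = (1 / 2 : ℂ) • (b x + (b x)ᵀ) := by
  ext i j
  have h : wMat (∑ t, coeff a b t x • dir t) i j
      = ∑ t, coeff a b t x * wMat (dir t) i j := by
    simp [wMat, Prod.snd_sum]
  rw [h, Fintype.sum_sum_type, Fintype.sum_prod_type]
  have h0 (k : Fin n) : wMat (dir (Sum.inl k)) i j = 0 := by simp [wMat, dir]
  simp only [h0, wMat_dir_inr, coeff, Sum.elim_inr, mul_zero, Finset.sum_const_zero, zero_add]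
  have h1 (p q : Fin n) : ∑ k, ∑ l, b x k l * (if k = p ∧ l = q then 1 else 0) = b x p q := by
    rw [Fintype.sum_eq_single p fun k hk => by simp [hk],
      Fintype.sum_eq_single q fun l hl => by simp [hl]]
    simp
  simp only [← mul_div_assoc, ← Finset.sum_div, mul_add, Finset.sum_add_distrib, h1,
    Matrix.smul_apply, Matrix.add_apply, transpose_apply, smul_eq_mul]
  ring

lemma wBar_sum_coeff_smul_dir (a : Coord n → Fin n → ℂ)
    (b : Coord n → Matrix (Fin n) (Fin n) ℂ) (x : Coord n) :
    wBar (∑ t, coeff a b t x • dir t)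
      = (1 / 2 : ℂ) • ((b x).map (starRingEnd ℂ) + ((b x).map (starRingEnd ℂ))ᵀ) := by
  rw [wBar, wMat_sum_coeff_smul_dir]
  ext i j
  simp [map_ofNat, mul_add]

lemma zBar_sum_coeff_smul_dir (a : Coord n → Fin n → ℂ)
    (b : Coord n → Matrix (Fin n) (Fin n) ℂ) (x : Coord n) :
    zBar (∑ t, coeff a b t x • dir t) = fun i => starRingEnd ℂ (a x i) := by
  funext i
  rw [zBar, sum_coeff_smul_dir_fst]

lemma norm_dotProduct_le {C S : ℝ} {u v : Fin n → ℂ} (hC : 0 ≤ C) (hS : 1 + ‖u‖ ^ 2 ≤ S)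
    (hv : ∀ i, ‖v i‖ ≤ C * (1 + ‖u‖)) : ‖u ⬝ᵥ v‖ ≤ 2 * n * C * S := by
  have h (i : Fin n) : ‖u i * v i‖ ≤ 2 * C * S := by
    rw [norm_mul]
    calc ‖u i‖ * ‖v i‖ ≤ ‖u‖ * (C * (1 + ‖u‖)) :=
          mul_le_mul (norm_le_pi_norm u i) (hv i) (norm_nonneg _) (norm_nonneg _)
      _ = C * (‖u‖ * (1 + ‖u‖)) := by ring
      _ ≤ C * (2 * S) := mul_le_mul_of_nonneg_left
          (by nlinarith [sq_nonneg (‖u‖ - 1), sq_nonneg ‖u‖]) hC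
      _ = 2 * C * S := by ring
  calc ‖u ⬝ᵥ v‖ ≤ ∑ i, ‖u i * v i‖ := norm_sum_le _ _
    _ ≤ ∑ _i : Fin n, 2 * C * S := Finset.sum_le_sum fun i _ => h i
    _ = 2 * n * C * S := by simp; ring

/-- A symmetric matrix pairs with `(b + bᵗ) / 2`, the `W`-part of `∑ b_{ij} ∇_{ij}`, as with `b`. -/
lemma trace_mul_symmetrized {m : Type*} [Fintype m] {G : Matrix m m ℂ} (hG : Gᵀ = G)
    (b : Matrix m m ℂ) : (G * ((1 / 2 : ℂ) • (b + bᵀ))).trace = (G * b).trace := by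
  have h : (G * bᵀ).trace = (G * b).trace := by
    rw [← trace_transpose, transpose_mul, transpose_transpose, hG, trace_mul_comm]
  rw [Matrix.mul_smul, trace_smul, Matrix.mul_add, trace_add, h, smul_eq_mul]
  ring

lemma dotProduct_symmetrized_mulVec {m : Type*} [Fintype m] (b : Matrix m m ℂ) (u : m → ℂ) :
    u ⬝ᵥ ((1 / 2 : ℂ) • (b + bᵀ)) *ᵥ u = u ⬝ᵥ b *ᵥ u := by
  have h : u ⬝ᵥ bᵀ *ᵥ u = u ⬝ᵥ b *ᵥ u := by
    rw [dotProduct_mulVec_comm_transpose, transpose_transpose, dotProduct_comm]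
  rw [smul_mulVec, add_mulVec, dotProduct_smul, dotProduct_add, h, smul_eq_mul]
  ring

lemma MemFK.integrableOn_mul {k : ℝ} {f g : Coord n → ℂ} (hf : MemFK k f) (hg : MemFK k g) :
    IntegrableOn (fun x => starRingEnd ℂ (f x) * g x * (density k x : ℂ)) (ball n) := by
  have hm : AEStronglyMeasurable (fun x => starRingEnd ℂ (f x) * g x * (density k x : ℂ))
      (volume.restrict (ball n)) :=
    ContinuousOn.aestronglyMeasurable
      (((continuous_conj.comp_continuousOn hf.1.continuousOn).mul hg.1.continuousOn).mul
        (continuous_ofReal.comp_continuousOn (contDiffOn_density k).continuousOn))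
      isOpen_ball.measurableSet
  refine (hf.2.add hg.2).mono' hm ?_
  refine (ae_restrict_iff' isOpen_ball.measurableSet).2 (Eventually.of_forall fun x hx => ?_)
  have hd : 0 ≤ density k x :=
    mul_nonneg (Real.rpow_nonneg (det_re_pos hx).le _) (Real.exp_nonneg _)
  rw [norm_mul, norm_mul, RCLike.norm_conj, norm_real, Real.norm_of_nonneg hd, Pi.add_apply,
    ← add_mul]
  refine mul_le_mul_of_nonneg_right ?_ hd
  nlinarith [two_mul_le_add_sq ‖f x‖ ‖g x‖, sq_nonneg ‖f x‖, sq_nonneg ‖g x‖]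

lemma conj_scalarProd (k : ℝ) (f g : Coord n → ℂ) :
    starRingEnd ℂ (scalarProd k f g) = scalarProd k g f := by
  rw [scalarProd, scalarProd, map_mul, conj_ofReal, ← integral_conj]
  congr 2
  ext x
  simp only [map_mul, conj_conj, conj_ofReal]
  ring

instance : (volume : Measure (Coord n)).IsAddHaarMeasure :=
  Measure.prod.instIsAddHaarMeasure _ _

/-- A criterion for `c + ∑ aᵢ ∂/∂zᵢ + ∑ b_{ij} ∇_{ij}` and `c' + ∑ a'ᵢ ∂/∂zᵢ + ∑ b'_{ij} ∇_{ij}`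
to be hermitian conjugate on their maximal domains. The hypothesis `hkey` is formal adjointness:
its left-hand side is the derivative of `log ρ₁` along the complexified vector field `X̄ - Y`. The
hypotheses `hl`, `hlC` say that this field differentiates `log det (1 - W W̄)` to a bounded
function, i.e. that it is tangent to the boundary of `𝒟ₙ`, and `ha'`, `hb'` bound its growth in
`z`. -/
theorem hermitianConjugate_firstOrder {k : ℝ} {c c' : Coord n → ℂ} {a a' : Coord n → Fin n → ℂ}
    {b b' : Coord n → Matrix (Fin n) (Fin n) ℂ} {l : Coord n → ℂ} {C : ℝ}
    (ha : ∀ i, ContDiff ℂ 1 fun x => a x i) (hb : ∀ i j, ContDiff ℂ 1 fun x => b x i j)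
    (ha' : ∀ i, ContDiff ℂ 1 fun x => a' x i) (hb' : ∀ i j, ContDiff ℂ 1 fun x => b' x i j)
    (haC : ∀ x ∈ ball n, ∀ i, ‖a x i‖ ≤ C * (1 + ‖x.1‖))
    (haC' : ∀ x ∈ ball n, ∀ i, ‖a' x i‖ ≤ C * (1 + ‖x.1‖))
    (hl : ∀ x ∈ ball n, (wBar x * mMat x * b' x).trace
      - (mMat x * wMat x * (b x).map (starRingEnd ℂ)).trace = l x)
    (hlC : ∀ x ∈ ball n, ‖l x‖ ≤ C)
    (hkey : ∀ x ∈ ball n, (k / 2 - n - 2) * l x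
      - ((fun i => starRingEnd ℂ (a x i)) ⬝ᵥ etaVec x - a' x ⬝ᵥ etaBar x
        + (etaVec x ⬝ᵥ (b x).map (starRingEnd ℂ) *ᵥ etaVec x
          - etaBar x ⬝ᵥ b' x *ᵥ etaBar x) / 2)
      = starRingEnd ℂ (c x) - c' x - starRingEnd ℂ (divergence a b x) + divergence a' b' x) :
    HermitianConjugate k (firstOrder c a b) (firstOrder c' a' b') := by
  intro f g hf hAf hg hBg
  suffices h : scalarProd k (firstOrder c a b f) g = scalarProd k f (firstOrder c' a' b' g) by
    refine ⟨h, ?_⟩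
    rw [← conj_scalarProd, ← h, conj_scalarProd]
  -- the normalization constant is a common factor, whatever its value
  rw [scalarProd, scalarProd]
  congr 1
  have htr (x : Coord n) (hx : x ∈ ball n) :
      (mMat x * (wMat (∑ t, coeff a' b' t x • dir t) * wBar x
        - wMat x * wBar (∑ t, coeff a b t x • dir t))).trace = l x := by
    have hG1 : (wBar x * mMat x)ᵀ = wBar x * mMat x := by
      rw [transpose_mul, transpose_wBar, wBar_mul_mMat hx]
    have hG2 : (mMat x * wMat x)ᵀ = mMat x * wMat x := by
      rw [transpose_mul, transpose_wMat, mMat_mul_wMat hx]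
    rw [wBar_sum_coeff_smul_dir, wMat_sum_coeff_smul_dir, Matrix.mul_sub, trace_sub, ← mul_assoc (mMat x),
      ← mul_assoc (mMat x), trace_mul_cycle, trace_mul_symmetrized hG1,
      trace_mul_symmetrized hG2, hl x hx]
  -- `C` bounds the derivative of `log det (1 - W W̄)`, `4 n C` that of `log (1 + |z|²)`
  refine setIntegral_adjoint isOpen_ball (contDiffOn_density k) contDiffOn_exhaust
    (fun x hx => exhaust_pos hx) (fun ε hε => isCompact_le_exhaust hε) dir
    (a := coeff a b) (b := coeff a' b') (c := c) (d := c') ?_ ?_ ?_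
    (C := C + 4 * n * C) ?_ hf.1 hg.1 (fun x _ => firstOrder_eq c a b f x)
    (fun x _ => firstOrder_eq c' a' b' g x) (hf.integrableOn_mul hg) (hAf.integrableOn_mul hg)
    (hf.integrableOn_mul hBg)
  · rintro (i | p)
    exacts [ha i, hb p.1 p.2]
  · rintro (i | p)
    exacts [ha' i, hb' p.1 p.2]
  · intro x hx
    refine (hasWirt_density k hx (htr x hx) (hasWirt_potF hx)).congr_val ?_
    rw [divergence_eq, divergence_eq, ← hkey x hx, zBar_sum_coeff_smul_dir,
      sum_coeff_smul_dir_fst, wBar_sum_coeff_smul_dir, wMat_sum_coeff_smul_dir,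
      dotProduct_symmetrized_mulVec, dotProduct_symmetrized_mulVec]
  · intro x hx
    refine ⟨_, hasWirt_exhaust hx (htr x hx), ?_⟩
    rw [zBar_sum_coeff_smul_dir, sum_coeff_smul_dir_fst]
    have hC : 0 ≤ C := (norm_nonneg _).trans (hlC x hx)
    have hS : 1 + ‖x.1‖ ^ 2 ≤ 1 + ∑ i, normSq (x.1 i) := by
      linarith [norm_sq_le_sum_normSq x]
    have hS0 := one_add_sum_normSq_pos x
    have h1 := norm_dotProduct_le (v := fun i => starRingEnd ℂ (a x i)) hC hS
      (by simpa using haC x hx)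
    have hz : ‖zBar x‖ = ‖x.1‖ := norm_star x.1
    have h2 := norm_dotProduct_le (u := zBar x) hC (hz.symm ▸ hS) (by simpa [hz] using haC' x hx)
    refine (norm_sub_le _ _).trans (add_le_add (hlC x hx) ?_)
    rw [norm_div, norm_real, Real.norm_of_nonneg hS0.le, div_le_iff₀ hS0]
    refine (norm_sub_le _ _).trans ?_
    rw [dotProduct_comm (a' x)]
    linarith

/-! ### The generators of the Jacobi algebra -/

lemma dz_const (i : Fin n) (c : ℂ) (x : Coord n) : dz i (fun _ => c) x = 0 := by
  simp [dz]

lemma nabla_const (i j : Fin n) (c : ℂ) (x : Coord n) : nabla i j (fun _ => c) x = 0 := by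
  simp [nabla, dw]

lemma dz_z (i j : Fin n) (x : Coord n) : dz i (fun y => y.1 j) x = if j = i then 1 else 0 := by
  rw [dz, show (fun y : Coord n => y.1 j) = zCLM j from rfl, (zCLM j).fderiv]
  simp [zCLM, Pi.single_apply]

lemma dz_wMat (i j k : Fin n) (x : Coord n) : dz i (fun y => wMat y j k) x = 0 := by
  rw [dz, show (fun y : Coord n => wMat y j k) = wCLM j k from rfl, (wCLM j k).fderiv]
  simp [wCLM]

lemma nabla_wMat (i j k l : Fin n) (x : Coord n) : nabla i j (fun y => wMat y k l) x
    = ((if i = k ∧ j = l then 1 else 0) + if i = l ∧ j = k then 1 else 0) / 2 := by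
  rw [← wMat_dir_inr (i, j), ← fderiv_dir_inr (p := (i, j)),
    show (fun y : Coord n => wMat y k l) = wCLM k l from rfl, (wCLM k l).fderiv]
  rfl

lemma contDiff_complex_z (i : Fin n) : ContDiff ℂ 1 fun x : Coord n => x.1 i := (zCLM i).contDiff

lemma contDiff_complex_wMat (i j : Fin n) : ContDiff ℂ 1 fun x : Coord n => wMat x i j :=
  (wCLM i j).contDiff

lemma dz_mul (i : Fin n) {f g : Coord n → ℂ} (hf : ContDiff ℂ 1 f) (hg : ContDiff ℂ 1 g)
    (x : Coord n) : dz i (fun y => f y * g y) x = f x * dz i g x + dz i f x * g x := by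
  rw [dz, fderiv_fun_mul (hf.differentiable one_ne_zero x) (hg.differentiable one_ne_zero x)]
  simp [dz, mul_comm]

lemma dz_add (i : Fin n) {f g : Coord n → ℂ} (hf : ContDiff ℂ 1 f) (hg : ContDiff ℂ 1 g)
    (x : Coord n) : dz i (fun y => f y + g y) x = dz i f x + dz i g x := by
  rw [dz, fderiv_fun_add (hf.differentiable one_ne_zero x) (hg.differentiable one_ne_zero x)]
  rfl

lemma nabla_mul (i j : Fin n) {f g : Coord n → ℂ} (hf : ContDiff ℂ 1 f) (hg : ContDiff ℂ 1 g)
    (x : Coord n) :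
    nabla i j (fun y => f y * g y) x = f x * nabla i j g x + nabla i j f x * g x := by
  rw [nabla, dw, fderiv_fun_mul (hf.differentiable one_ne_zero x)
    (hg.differentiable one_ne_zero x)]
  simp [nabla, dw]
  ring

lemma wMat_comm (x : Coord n) (i j : Fin n) : wMat x i j = wMat x j i :=
  congrFun (congrFun (transpose_wMat x) j) i

lemma trace_mul_vecMulVec {m : Type*} [Fintype m] (G : Matrix m m ℂ) (v w : m → ℂ) :
    (G * vecMulVec v w).trace = (G *ᵥ v) ⬝ᵥ w := by
  rw [mul_vecMulVec, trace_vecMulVec]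

lemma dotProduct_vecMulVec_mulVec {m : Type*} [Fintype m] (u v w : m → ℂ) :
    u ⬝ᵥ vecMulVec v w *ᵥ u = (v ⬝ᵥ u) * (w ⬝ᵥ u) := by
  rw [dotProduct_mulVec, vecMul_vecMulVec, smul_dotProduct, smul_eq_mul, dotProduct_comm u]

lemma map_conj_vecMulVec {m : Type*} (v w : m → ℂ) :
    (vecMulVec v w).map (starRingEnd ℂ) = vecMulVec (star v) (star w) := by
  ext i j
  simp [vecMulVec_apply]

lemma mulVec_wMat_row (A : Matrix (Fin n) (Fin n) ℂ) (x : Coord n) (i : Fin n) :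
    A *ᵥ wMat x i = fun j => (A * wMat x) j i := by
  funext j
  simp only [mulVec, dotProduct, mul_apply, wMat_comm x i]

lemma mulVec_wBar_row (A : Matrix (Fin n) (Fin n) ℂ) (x : Coord n) (i : Fin n) :
    A *ᵥ wBar x i = fun j => (A * wBar x) j i := by
  funext j
  have h (l : Fin n) : wBar x i l = wBar x l i := congrFun (congrFun (transpose_wBar x) l) i
  simp only [mulVec, dotProduct, mul_apply, h]

lemma wMat_row_dotProduct_etaBar {x : Coord n} (hx : x ∈ ball n) (i : Fin n) :
    wMat x i ⬝ᵥ etaBar x = etaVec x i - x.1 i :=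
  congrFun (wMat_mulVec_etaBar hx) i

lemma wBar_row_dotProduct_etaVec {x : Coord n} (hx : x ∈ ball n) (i : Fin n) :
    wBar x i ⬝ᵥ etaVec x = etaBar x i - zBar x i :=
  congrFun (wBar_mulVec_etaVec hx) i

lemma star_single_one (i : Fin n) : star (Pi.single i 1 : Fin n → ℂ) = Pi.single i 1 := by
  rw [← Pi.single_star, star_one]

lemma norm_single_le (x : Coord n) {c : ℂ} (hc : ‖c‖ ≤ 1 + ‖x.1‖) (i j : Fin n) :
    ‖(Pi.single i c : Fin n → ℂ) j‖ ≤ 1 * (1 + ‖x.1‖) := by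
  rw [Pi.single_apply, one_mul]
  split_ifs
  · exact hc
  · rw [norm_zero]; positivity

/-- The field `∂/∂z̄ᵣ - ∑ w_{ri} ∂/∂zᵢ` does not move `W`. -/
theorem hermitianConjugate_opA (k : ℝ) (r : Fin n) :
    HermitianConjugate k (opA r) (opAdag r) := by
  have hA : opA r = firstOrder (fun _ : Coord n => 0) (fun _ => Pi.single r 1) (fun _ => 0) := by
    funext f x
    simp [opA, firstOrder, Pi.single_apply]
  have hB : opAdag r = firstOrder (fun x : Coord n => x.1 r) (fun x => wMat x r)
      (fun _ => 0) := by
    funext f x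
    simp [opAdag, firstOrder]
  rw [hA, hB]
  refine hermitianConjugate_firstOrder (l := fun _ => 0) (C := 1) (fun i => contDiff_const)
    (fun i j => contDiff_const) (fun i => contDiff_complex_wMat r i) (fun i j => contDiff_const)
    (fun x hx i => norm_single_le x (by simp) r i) (fun x hx i => ?_) (fun x hx => ?_)
    (fun x hx => ?_) (fun x hx => ?_)
  · linarith [norm_nonneg x.1, norm_wMat_le_one hx.posSemidef r i]
  · simp
  · simp
  · have h : (fun i => starRingEnd ℂ ((Pi.single r 1 : Fin n → ℂ) i)) ⬝ᵥ etaVec x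
        = etaVec x r := by
      simp [dotProduct, Pi.single_apply]
    rw [h, wMat_row_dotProduct_etaBar hx]
    simp [divergence, dz_const, nabla_const, dz_wMat]

/-- Here `V` annihilates both `log det (1 - W W̄)` and `F`: it comes from the unitary group, which
acts by `z ↦ u z`, `W ↦ u W uᵗ`. -/
theorem hermitianConjugate_opK0 (k : ℝ) (r s : Fin n) :
    HermitianConjugate k (opK0 (fun _ => k) r s) (opK0 (fun _ => k) s r) := by
  have hK (r s : Fin n) : opK0 (fun _ => k) r s = firstOrder
      (fun _ : Coord n => if r = s then (k : ℂ) / 4 else 0)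
      (fun x => Pi.single s (x.1 r / 2))
      (fun x => vecMulVec (wMat x r) (Pi.single s 1)) := by
    funext f x
    simp [opK0, firstOrder, vecMulVec_apply, Pi.single_apply]
  have hdiv (r s : Fin n) (x : Coord n) : divergence (fun x => Pi.single s (x.1 r / 2))
      (fun x => vecMulVec (wMat x r) (Pi.single s 1)) x
      = if r = s then ((n : ℂ) + 2) / 2 else 0 := by
    have h1 (i : Fin n) : dz i (fun y : Coord n => (Pi.single s (y.1 r / 2) : Fin n → ℂ) i) x
        = if i = s then (if r = s then 1 / 2 else 0) else 0 := by
      by_cases hi : i = s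
      · simp only [Pi.single_apply, hi, if_true, div_eq_mul_inv,
          dz_mul _ (contDiff_complex_z r) contDiff_const, dz_const, dz_z]
        simp
      · simp only [Pi.single_apply, hi, if_false, dz_const]
    have h2 (i j : Fin n) : nabla i j
        (fun y : Coord n => vecMulVec (wMat y r) (Pi.single s 1 : Fin n → ℂ) i j) x
        = if j = s then ((if i = r ∧ j = i then 1 else 0) + if j = r then 1 else 0) / 2 else 0 := by
      by_cases hj : j = s
      · simp only [vecMulVec_apply, Pi.single_apply, hj, if_true, mul_one, nabla_wMat, true_and]
      · simp only [vecMulVec_apply, Pi.single_apply, hj, if_false, mul_zero, nabla_const]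
    simp only [divergence, h1, h2]
    simp only [Finset.sum_add_distrib, ite_and, ← Finset.sum_div, Finset.sum_ite_eq',
      Finset.mem_univ, if_true, Finset.sum_const, Finset.card_univ, Fintype.card_fin,
      nsmul_eq_mul, eq_comm (a := s) (b := r)]
    split_ifs <;> ring
  have hCz (r s : Fin n) (i : Fin n) :
      ContDiff ℂ 1 fun x : Coord n => (Pi.single s (x.1 r / 2) : Fin n → ℂ) i := by
    simp only [Pi.single_apply]
    split_ifs
    exacts [(contDiff_complex_z r).div_const 2, contDiff_const]
  have hCw (r s : Fin n) (i j : Fin n) : ContDiff ℂ 1 fun x : Coord n =>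
      vecMulVec (wMat x r) (Pi.single s 1 : Fin n → ℂ) i j :=
    (contDiff_complex_wMat r i).mul contDiff_const
  have hz (x : Coord n) (r : Fin n) : ‖x.1 r / 2‖ ≤ 1 + ‖x.1‖ := by
    rw [norm_div, RCLike.norm_ofNat]
    linarith [norm_nonneg x.1, norm_le_pi_norm x.1 r]
  rw [hK, hK]
  refine hermitianConjugate_firstOrder (l := fun _ => 0) (C := 1) (hCz r s) (hCw r s) (hCz s r)
    (hCw s r) (fun x hx i => norm_single_le x (hz x r) s i)
    (fun x hx i => norm_single_le x (hz x s) r i) (fun x hx => ?_) (fun x hx => ?_)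
    (fun x hx => ?_)
  · rw [map_conj_vecMulVec, star_single_one, trace_mul_vecMulVec, trace_mul_vecMulVec,
      dotProduct_single_one, dotProduct_single_one, show star (wMat x r) = wBar x r from rfl,
      mulVec_wMat_row, mulVec_wBar_row, mul_assoc, mul_assoc, mMat_mul_wMat_mul_wBar hx,
      mMat_mul_wMat hx, wBar_mul_wMat_mul_mMat_transpose hx]
    simp [one_apply, eq_comm]
  · simp
  · rw [hdiv, hdiv, map_conj_vecMulVec, star_single_one, dotProduct_vecMulVec_mulVec,
      dotProduct_vecMulVec_mulVec, show star (wMat x r) = wBar x r from rfl,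
      wMat_row_dotProduct_etaBar hx, wBar_row_dotProduct_etaVec hx, single_one_dotProduct,
      single_one_dotProduct, single_dotProduct]
    have h : (fun i => starRingEnd ℂ ((Pi.single s (x.1 r / 2) : Fin n → ℂ) i))
        = Pi.single s (zBar x r / 2) := by
      funext i
      simp [Pi.single_apply, apply_ite (starRingEnd ℂ), zBar, map_ofNat]
    rw [h, single_dotProduct]
    simp only [eq_comm (a := s) (b := r), apply_ite (starRingEnd ℂ), map_zero, map_div₀,
      map_ofNat, map_add, map_natCast, conj_ofReal]
    ring

/-- Here `V log det (1 - W W̄) = -w_{rs}` and `V F = zᵣ zₛ / 2`, and the divergence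
`(n + 2) w_{rs}` accounts for the shift between `k / 2` and `p`. -/
theorem hermitianConjugate_opKplus (k : ℝ) (r s : Fin n) :
    HermitianConjugate k (opKminus r s) (opKplus (fun _ => k) r s) := by
  have hA : opKminus r s = firstOrder (fun _ : Coord n => 0) (fun _ _ => 0)
      (fun _ => vecMulVec (Pi.single r 1) (Pi.single s 1)) := by
    funext f x
    simp [opKminus, firstOrder, vecMulVec_apply, Pi.single_apply]
  have hB : opKplus (fun _ => k) r s = firstOrder
      (fun x : Coord n => (k : ℂ) / 2 * wMat x r s + x.1 r * x.1 s / 2)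
      (fun x i => 1 / 2 * (x.1 s * wMat x r i + x.1 r * wMat x s i))
      (fun x => vecMulVec (wMat x r) (wMat x s)) := by
    funext f x
    simp only [opKplus, firstOrder, vecMulVec_apply]
    congr 1
    · congr 1
      · ring
      · rw [Finset.mul_sum]
        refine Finset.sum_congr rfl fun i _ => ?_
        rw [wMat_comm x i r, wMat_comm x i s, mul_assoc]
    · rw [Finset.sum_comm]
      refine Finset.sum_congr rfl fun i _ => Finset.sum_congr rfl fun j _ => ?_
      rw [wMat_comm x j s, mul_comm (wMat x s j)]
  have hCw (i : Fin n) : ContDiff ℂ 1 fun x : Coord n =>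
      1 / 2 * (x.1 s * wMat x r i + x.1 r * wMat x s i) :=
    contDiff_const.mul (((contDiff_complex_z s).mul (contDiff_complex_wMat r i)).add
      ((contDiff_complex_z r).mul (contDiff_complex_wMat s i)))
  have hdiv (x : Coord n) : divergence
      (fun x i => 1 / 2 * (x.1 s * wMat x r i + x.1 r * wMat x s i))
      (fun x => vecMulVec (wMat x r) (wMat x s)) x = (n + 2) * wMat x r s := by
    have h1 (i : Fin n) :
        dz i (fun y : Coord n => 1 / 2 * (y.1 s * wMat y r i + y.1 r * wMat y s i)) x
        = ((if s = i then wMat x r i else 0) + if r = i then wMat x s i else 0) / 2 := by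
      rw [dz_mul _ contDiff_const (((contDiff_complex_z s).mul (contDiff_complex_wMat r i)).add
          ((contDiff_complex_z r).mul (contDiff_complex_wMat s i))),
        dz_add _ ((contDiff_complex_z s).mul (contDiff_complex_wMat r i))
          ((contDiff_complex_z r).mul (contDiff_complex_wMat s i)),
        dz_mul _ (contDiff_complex_z s) (contDiff_complex_wMat r i),
        dz_mul _ (contDiff_complex_z r) (contDiff_complex_wMat s i)]
      simp only [dz_const, dz_z, dz_wMat, ite_mul]
      ring_nf
    have h2 (i j : Fin n) : nabla i j (fun y : Coord n => vecMulVec (wMat y r) (wMat y s) i j) x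
        = ((if j = s then if i = s then wMat x r i else 0 else 0)
          + (if i = s then wMat x r i else 0) + (if j = r then if i = r then wMat x s j else 0 else 0)
          + if j = r then wMat x s j else 0) / 2 := by
      simp only [vecMulVec_apply]
      rw [nabla_mul _ _ (contDiff_complex_wMat r i) (contDiff_complex_wMat s j), nabla_wMat,
        nabla_wMat]
      grind
    simp only [divergence, h1, h2]
    simp only [Finset.sum_add_distrib, ← Finset.sum_div, Finset.sum_ite_eq', Finset.sum_ite_eq,
      Finset.mem_univ, if_true, Finset.sum_const, Finset.card_univ, Fintype.card_fin,
      nsmul_eq_mul, ← Finset.mul_sum, wMat_comm x s r]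
    ring
  rw [hA, hB]
  refine hermitianConjugate_firstOrder (l := fun x => - wMat x r s) (C := 1)
    (fun i => contDiff_const) (fun i j => contDiff_const) hCw
    (fun i j => (contDiff_complex_wMat r i).mul (contDiff_complex_wMat s j))
    (fun x hx i => ?_) (fun x hx i => ?_) (fun x hx => ?_) (fun x hx => ?_) (fun x hx => ?_)
  · rw [norm_zero]; linarith [norm_nonneg x.1]
  · have h (p q : Fin n) : ‖x.1 p * wMat x q i‖ ≤ ‖x.1‖ := by
      rw [norm_mul]
      exact (mul_le_of_le_one_right (norm_nonneg _) (norm_wMat_le_one hx.posSemidef q i)).trans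
        (norm_le_pi_norm x.1 p)
    rw [norm_mul, norm_div, norm_one, RCLike.norm_ofNat]
    linarith [norm_add_le (x.1 s * wMat x r i) (x.1 r * wMat x s i), h s r, h r s,
      norm_nonneg x.1]
  · rw [map_conj_vecMulVec, star_single_one, star_single_one, trace_mul_vecMulVec,
      trace_mul_vecMulVec, dotProduct_single_one, mulVec_single_one, mulVec_wMat_row,
      dotProduct_comm]
    have h : wMat x s ⬝ᵥ (fun j => (wBar x * mMat x * wMat x) j r)
        = (wMat x * (wBar x * mMat x * wMat x)) s r := rfl
    rw [h, ← mul_assoc, wMat_mul_wBar_mul_mMat hx, Matrix.sub_mul, Matrix.one_mul,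
      Matrix.sub_apply, wMat_comm x r s]
    simp
  · rw [norm_neg]; exact norm_wMat_le_one hx.posSemidef r s
  · have h : (fun i => 1 / 2 * (x.1 s * wMat x r i + x.1 r * wMat x s i)) ⬝ᵥ etaBar x
        = (x.1 s * (wMat x r ⬝ᵥ etaBar x) + x.1 r * (wMat x s ⬝ᵥ etaBar x)) / 2 := by
      simp only [dotProduct, Finset.mul_sum, ← Finset.sum_add_distrib, Finset.sum_div]
      exact Finset.sum_congr rfl fun i _ => by ring
    have h0 : divergence (fun (_ : Coord n) (_ : Fin n) => (0 : ℂ))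
        (fun _ => vecMulVec (Pi.single r 1) (Pi.single s 1)) x = 0 := by
      simp [divergence, dz_const, nabla_const]
    rw [hdiv, h0, h, map_conj_vecMulVec, star_single_one, star_single_one,
      dotProduct_vecMulVec_mulVec, dotProduct_vecMulVec_mulVec, single_one_dotProduct,
      single_one_dotProduct, wMat_row_dotProduct_etaBar hx, wMat_row_dotProduct_etaBar hx]
    simp only [map_zero]
    rw [show (fun _ : Fin n => (0 : ℂ)) = 0 from rfl, zero_dotProduct]
    ring

end SiegelJacobi

end

theorem lemma4p3 (n : ℕ) (k : ℝ) :
    (∀ i : Fin n,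
      SiegelJacobi.HermitianConjugate k (SiegelJacobi.opA i) (SiegelJacobi.opAdag i)) ∧
    (∀ i j : Fin n,
      SiegelJacobi.HermitianConjugate k
        (SiegelJacobi.opKminus i j) (SiegelJacobi.opKplus (fun _ => k) i j)) ∧
    (∀ i j : Fin n,
      SiegelJacobi.HermitianConjugate k
        (SiegelJacobi.opK0 (fun _ => k) i j) (SiegelJacobi.opK0 (fun _ => k) j i)) :=
  ⟨fun i => SiegelJacobi.hermitianConjugate_opA k i,
    fun i j => SiegelJacobi.hermitianConjugate_opKplus k i j,
    fun i j => SiegelJacobi.hermitianConjugate_opK0 k i j⟩
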